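/- Let $\mathcal S := [0,+\infty) + i(-1,1)\subset\mathbb C$. For $V\in L^1(\mathbb R)$ (complex-valued) and $\varepsilon\in\mathbb R$ let $H_\varepsilon = -\frac{d^2}{dx^2} + i\,\mathrm{sgn}(x) \,\dot{+}\, \varepsilon V$ be the operator in $L^2(\mathbb R)$ defined as a sum of forms, that is, the operator associated with the sesquilinear form $$h_\varepsilon(\psi,\phi) = \int_{\mathbb R}\psi'\bar\phi'\,dx + i\int_0^{\infty}\psi\bar\phi\,dx - i\int_{-\infty}^0\psi\bar\phi\,dx + \varepsilon\int_{\mathbb R}V\psi\bar\phi\,dx$$ on $\{\psi\in W^{1,2}(\mathbb R) : |V|^{1/2}\psi\in L^2(\mathbb R)\}$ $(=W^{1,2}(\mathbb R))$: a function $\psi$ of the form domain belongs to $\mathrm{Dom}(H_\varepsilon)$, with $H_\varepsilon\psi=\eta\in L^2(\mathbb R)$, if and only if $h_\varepsilon(\psi,\phi)=\int_{\mathbb R}\eta\bar\phi\,dx$ for all $\phi$ in the form domain. Let $\sigma_{\mathrm p}(H_\varepsilon)$ denote the set of eigenvalues of $H_\varepsilon$. (i) Let $n\ge 2$ be an integer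 and let $V\in L^1\big(\mathbb R,(1+x^{2n})\,dx\big)\cap W^{1,1}(\mathbb R)$. There exist positive constants $\varepsilon_0$ and $C$ (depending on $n$ and $V$) such that, for all $\varepsilon\in(0,\varepsilon_0)$, $$\sigma_{\mathrm p}(H_\varepsilon)\subset \overline{\mathcal S}\cap\Big\{z : \Re z\ge \frac{C}{\varepsilon^{2n}}\Big\}.$$ (ii) In particular, if $V$ belongs to the Schwartz space $\mathscr S(\mathbb R)$, then the eigenvalues escape to infinity faster than any power of $\varepsilon^{-1}$ as $\varepsilon\to0^+$: for every $N\in\mathbb N$ there exist positive constants $\varepsilon_0$ and $C$ such that, for all $\varepsilon\in(0,\varepsilon_0)$, every eigenvalue $\lambda$ of $H_\varepsilon$ is non-zero and satisfies $|\lambda|^{-1}\le C\,\varepsilon^{N}$. -/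

import Mathlib

open MeasureTheory Set
open scoped ENNReal ContDiff SchwartzMap ComplexConjugate

/-- The Hilbert space `L²(ℝ)` of complex-valued functions. -/
abbrev L2R : Type := Lp ℂ 2 (volume : Measure ℝ)

/-! ### Weak derivatives and the Sobolev spaces `W^{1,p}(ℝ)` -/

/-- `g` is a weak derivative of `f` on `ℝ` (tested against `C_c^∞(ℝ)`). -/
def HasWeakDeriv (f g : ℝ → ℂ) : Prop :=
  LocallyIntegrable f ∧ LocallyIntegrable g ∧
    ∀ φ : ℝ → ℝ, ContDiff ℝ ∞ φ → HasCompactSupport φ →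
      ∫ x, deriv φ x • f x = - ∫ x, φ x • g x

open Classical in
/-- The weak derivative of `f` (unique up to a.e. equality), and `0` if there is none. -/
noncomputable def weakDeriv (f : ℝ → ℂ) : ℝ → ℂ :=
  if h : ∃ g, HasWeakDeriv f g then Classical.choose h else 0

/-- `f ∈ W^{1,p}(ℝ)`. -/
def MemW1 (p : ℝ≥0∞) (f : ℝ → ℂ) : Prop :=
  MemLp f p ∧ ∃ g : ℝ → ℂ, HasWeakDeriv f g ∧ MemLp g p

theorem HasWeakDeriv.unique {f g₁ g₂ : ℝ → ℂ} (h₁ : HasWeakDeriv f g₁)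
    (h₂ : HasWeakDeriv f g₂) : g₁ =ᵐ[volume] g₂ := by
  refine ae_eq_of_integral_contDiff_smul_eq h₁.2.1 h₂.2.1 fun φ hφ hc => ?_
  have e₁ := h₁.2.2 φ hφ hc
  have e₂ := h₂.2.2 φ hφ hc
  exact neg_injective (e₁.symm.trans e₂)

theorem HasWeakDeriv.congr {f f' g : ℝ → ℂ} (h : HasWeakDeriv f g)
    (hf : f =ᵐ[volume] f') : HasWeakDeriv f' g := by
  refine ⟨h.1.congr hf, h.2.1, fun φ hφ hc => ?_⟩
  rw [← h.2.2 φ hφ hc]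
  refine integral_congr_ae ?_
  filter_upwards [hf] with x hx
  rw [hx]

theorem HasWeakDeriv.add {f₁ f₂ g₁ g₂ : ℝ → ℂ} (h₁ : HasWeakDeriv f₁ g₁)
    (h₂ : HasWeakDeriv f₂ g₂) : HasWeakDeriv (f₁ + f₂) (g₁ + g₂) := by
  refine ⟨h₁.1.add h₂.1, h₁.2.1.add h₂.2.1, fun φ hφ hc => ?_⟩
  have hd : Continuous (deriv φ) := hφ.continuous_deriv (by simp)
  simp only [Pi.add_apply, smul_add]
  rw [integral_add (h₁.1.integrable_smul_left_of_hasCompactSupport hd hc.deriv)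
      (h₂.1.integrable_smul_left_of_hasCompactSupport hd hc.deriv),
    integral_add (h₁.2.1.integrable_smul_left_of_hasCompactSupport hφ.continuous hc)
      (h₂.2.1.integrable_smul_left_of_hasCompactSupport hφ.continuous hc),
    h₁.2.2 φ hφ hc, h₂.2.2 φ hφ hc, neg_add]

theorem HasWeakDeriv.const_smul {f g : ℝ → ℂ} (c : ℂ) (h : HasWeakDeriv f g) :
    HasWeakDeriv (c • f) (c • g) := by
  refine ⟨h.1.smul c, h.2.1.smul c, fun φ hφ hc => ?_⟩
  simp only [Pi.smul_apply, smul_comm _ c]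
  rw [integral_smul, integral_smul, h.2.2 φ hφ hc, smul_neg]

theorem HasWeakDeriv.weakDeriv_ae_eq {f g : ℝ → ℂ} (h : HasWeakDeriv f g) :
    weakDeriv f =ᵐ[volume] g := by
  have hex : ∃ g, HasWeakDeriv f g := ⟨g, h⟩
  rw [weakDeriv, dif_pos hex]
  exact (Classical.choose_spec hex).unique h

/-- A smooth function is weakly differentiable. -/
theorem hasWeakDeriv_of_contDiff (u : ℝ → ℝ) (hu : ContDiff ℝ ∞ u) :
    HasWeakDeriv (fun x => (u x : ℂ)) (fun x => ((deriv u x : ℝ) : ℂ)) := by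
  have hd : Continuous (deriv u) := hu.continuous_deriv (by simp)
  refine ⟨(Complex.continuous_ofReal.comp hu.continuous).locallyIntegrable,
    (Complex.continuous_ofReal.comp hd).locallyIntegrable, fun φ hφ hc => ?_⟩
  have hdφ : Continuous (deriv φ) := hφ.continuous_deriv (by simp)
  have hφd : ∀ x, HasDerivAt φ (deriv φ x) x := fun x =>
    (hφ.differentiable (by simp) x).hasDerivAt
  have hud : ∀ x, HasDerivAt u (deriv u x) x := fun x =>
    (hu.differentiable (by simp) x).hasDerivAt
  have key := integral_mul_deriv_eq_deriv_mul_of_integrable (u := u) (v := φ)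
    (u' := deriv u) (v' := deriv φ) (fun x _ => hud x) (fun x _ => hφd x)
    ((hu.continuous.mul hdφ).integrable_of_hasCompactSupport (hc.deriv.mul_left))
    ((hd.mul hφ.continuous).integrable_of_hasCompactSupport (hc.mul_left))
    ((hu.continuous.mul hφ.continuous).integrable_of_hasCompactSupport (hc.mul_left))
  simp only [Complex.real_smul, ← Complex.ofReal_mul, integral_complex_ofReal]
  simp only [mul_comm (deriv φ _), mul_comm (φ _)]
  rw [key, Complex.ofReal_neg]

theorem MemW1.congr {p : ℝ≥0∞} {f f' : ℝ → ℂ} (h : MemW1 p f) (hf : f =ᵐ[volume] f') :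
    MemW1 p f' := by
  obtain ⟨h1, g, hg, hgp⟩ := h
  exact ⟨h1.ae_eq hf, g, hg.congr hf, hgp⟩

theorem MemW1.memLp_weakDeriv {p : ℝ≥0∞} {f : ℝ → ℂ} (h : MemW1 p f) :
    HasWeakDeriv f (weakDeriv f) ∧ MemLp (weakDeriv f) p := by
  obtain ⟨-, g, hg, hgp⟩ := h
  have hex : ∃ g, HasWeakDeriv f g := ⟨g, hg⟩
  refine ⟨?_, hgp.ae_eq hg.weakDeriv_ae_eq.symm⟩
  rw [weakDeriv, dif_pos hex]
  exact Classical.choose_spec hex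

/-! ### The sesquilinear form of the perturbed operator -/

/-- The form domain `W^{1,2}(ℝ) ∩ {ψ ∈ L²(ℝ) : |V|^{1/2} ψ ∈ L²(ℝ)}`. -/
noncomputable def formDomain (V : ℝ → ℂ) : Submodule ℂ L2R where
  carrier := {ψ | MemW1 2 ψ ∧ MemLp (fun x => (Real.sqrt ‖V x‖ : ℂ) * ψ x) 2}
  zero_mem' := by
    have h0 : (fun _ => 0 : ℝ → ℂ) =ᵐ[volume] ((0 : L2R) : ℝ → ℂ) :=
      (Lp.coeFn_zero ℂ 2 volume).symm
    refine ⟨MemW1.congr (f := fun _ => 0) ⟨MemLp.zero', fun _ => 0, ⟨?_, ?_, ?_⟩, MemLp.zero'⟩ h0,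
      MemLp.ae_eq ?_ (MemLp.zero' : MemLp (fun _ => (0 : ℂ)) 2 (volume : Measure ℝ))⟩
    · exact locallyIntegrable_zero
    · exact locallyIntegrable_zero
    · intros; simp
    · filter_upwards [h0] with x hx
      simp
  add_mem' := by
    rintro ψ₁ ψ₂ ⟨⟨_, g₁, hg₁, hp₁⟩, hv₁⟩ ⟨⟨_, g₂, hg₂, hp₂⟩, hv₂⟩
    refine ⟨⟨Lp.memLp _, g₁ + g₂, (hg₁.add hg₂).congr (Lp.coeFn_add ψ₁ ψ₂).symm, hp₁.add hp₂⟩,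
      (hv₁.add hv₂).ae_eq ?_⟩
    filter_upwards [Lp.coeFn_add ψ₁ ψ₂] with x hx
    simp only [hx, Pi.add_apply]
    ring
  smul_mem' := by
    rintro c ψ ⟨⟨_, g, hg, hp⟩, hv⟩
    refine ⟨⟨Lp.memLp _, c • g, (hg.const_smul c).congr (Lp.coeFn_smul c ψ).symm,
      hp.const_smul c⟩, (hv.const_smul c).ae_eq ?_⟩
    filter_upwards [Lp.coeFn_smul c ψ] with x hx
    simp only [Pi.smul_apply, hx, smul_eq_mul]
    ring

/-- The sesquilinear form
`h_ε(ψ, φ) = ∫ ψ' φ̄' + i ∫_0^∞ ψ φ̄ - i ∫_{-∞}^0 ψ φ̄ + ε ∫ V ψ φ̄`. -/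
noncomputable def perturbedForm (V : ℝ → ℂ) (ε : ℝ) (ψ φ : L2R) : ℂ :=
  (∫ x, weakDeriv ψ x * conj (weakDeriv φ x))
    + Complex.I * (∫ x in Ioi 0, ψ x * conj (φ x))
    - Complex.I * (∫ x in Iio 0, ψ x * conj (φ x))
    + ε * ∫ x, V x * ψ x * conj (φ x)

theorem integrable_mul_conj {f g : ℝ → ℂ} (hf : MemLp f 2) (hg : MemLp g 2) :
    Integrable (fun x => f x * conj (g x)) :=
  MemLp.integrable_mul hf hg.star

theorem integrable_potential {V : ℝ → ℂ} (hV : AEStronglyMeasurable V) {ψ φ : L2R}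
    (hψ : ψ ∈ formDomain V) (hφ : φ ∈ formDomain V) :
    Integrable (fun x => V x * ψ x * conj (φ x)) := by
  refine (integrable_mul_conj hψ.2 hφ.2).mono
    ((hV.mul (Lp.aestronglyMeasurable ψ)).mul (Lp.aestronglyMeasurable φ).star) ?_
  refine Filter.Eventually.of_forall fun x => le_of_eq ?_
  simp only [norm_mul, RCLike.norm_conj, Complex.norm_real, Real.norm_eq_abs,
    abs_of_nonneg (Real.sqrt_nonneg _)]
  have := Real.mul_self_sqrt (norm_nonneg (V x))
  linear_combination (-‖ψ x‖ * ‖φ x‖) * this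

theorem perturbedForm_add {V : ℝ → ℂ} (hV : AEStronglyMeasurable V) (ε : ℝ) {ψ₁ ψ₂ φ : L2R}
    (h₁ : ψ₁ ∈ formDomain V) (h₂ : ψ₂ ∈ formDomain V) (hφ : φ ∈ formDomain V) :
    perturbedForm V ε (ψ₁ + ψ₂) φ = perturbedForm V ε ψ₁ φ + perturbedForm V ε ψ₂ φ := by
  have d₁ := h₁.1.memLp_weakDeriv
  have d₂ := h₂.1.memLp_weakDeriv
  have dφ := hφ.1.memLp_weakDeriv
  have hw : weakDeriv (ψ₁ + ψ₂ : L2R) =ᵐ[volume] weakDeriv ψ₁ + weakDeriv ψ₂ :=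
    ((d₁.1.add d₂.1).congr (Lp.coeFn_add ψ₁ ψ₂).symm).weakDeriv_ae_eq
  have hc := Lp.coeFn_add ψ₁ ψ₂
  have i₁ := integrable_mul_conj (Lp.memLp ψ₁) (Lp.memLp φ)
  have i₂ := integrable_mul_conj (Lp.memLp ψ₂) (Lp.memLp φ)
  have e₁ : ∫ x, weakDeriv (ψ₁ + ψ₂ : L2R) x * conj (weakDeriv φ x)
      = (∫ x, weakDeriv ψ₁ x * conj (weakDeriv φ x))
        + ∫ x, weakDeriv ψ₂ x * conj (weakDeriv φ x) := by
    rw [← integral_add (integrable_mul_conj d₁.2 dφ.2) (integrable_mul_conj d₂.2 dφ.2)]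
    refine integral_congr_ae ?_
    filter_upwards [hw] with x hx
    simp only [hx, Pi.add_apply]
    ring
  have e₂ : ∀ s : Set ℝ, ∫ x in s, (ψ₁ + ψ₂ : L2R) x * conj (φ x)
      = (∫ x in s, ψ₁ x * conj (φ x)) + ∫ x in s, ψ₂ x * conj (φ x) := fun s => by
    rw [← integral_add i₁.integrableOn i₂.integrableOn]
    refine integral_congr_ae (ae_restrict_of_ae ?_)
    filter_upwards [hc] with x hx
    simp only [hx, Pi.add_apply]
    ring
  have e₃ : ∫ x, V x * (ψ₁ + ψ₂ : L2R) x * conj (φ x)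
      = (∫ x, V x * ψ₁ x * conj (φ x)) + ∫ x, V x * ψ₂ x * conj (φ x) := by
    rw [← integral_add (integrable_potential hV h₁ hφ) (integrable_potential hV h₂ hφ)]
    refine integral_congr_ae ?_
    filter_upwards [hc] with x hx
    simp only [hx, Pi.add_apply]
    ring
  simp only [perturbedForm, e₁, e₂, e₃]
  ring

theorem perturbedForm_smul {V : ℝ → ℂ} (ε : ℝ) (c : ℂ) {ψ φ : L2R} (h : ψ ∈ formDomain V) :
    perturbedForm V ε (c • ψ) φ = c * perturbedForm V ε ψ φ := by
  have d := h.1.memLp_weakDeriv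
  have hw : weakDeriv (c • ψ : L2R) =ᵐ[volume] c • weakDeriv ψ :=
    ((d.1.const_smul c).congr (Lp.coeFn_smul c ψ).symm).weakDeriv_ae_eq
  have hc := Lp.coeFn_smul c ψ
  have e₁ : ∫ x, weakDeriv (c • ψ : L2R) x * conj (weakDeriv φ x)
      = c * ∫ x, weakDeriv ψ x * conj (weakDeriv φ x) := by
    rw [← integral_const_mul]
    refine integral_congr_ae ?_
    filter_upwards [hw] with x hx
    simp [hx, mul_assoc]
  have e₂ : ∀ s : Set ℝ, ∫ x in s, (c • ψ : L2R) x * conj (φ x)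
      = c * ∫ x in s, ψ x * conj (φ x) := fun s => by
    rw [← integral_const_mul]
    refine integral_congr_ae (ae_restrict_of_ae ?_)
    filter_upwards [hc] with x hx
    simp [hx, mul_assoc]
  have e₃ : ∫ x, V x * (c • ψ : L2R) x * conj (φ x)
      = c * ∫ x, V x * ψ x * conj (φ x) := by
    rw [← integral_const_mul]
    refine integral_congr_ae ?_
    filter_upwards [hc] with x hx
    simp only [hx, Pi.smul_apply, smul_eq_mul]
    ring
  simp only [perturbedForm, e₁, e₂, e₃]
  ring

/-! ### The operator `H_ε` associated with the form -/

/-- The graph of the operator associated with `h_ε`: the pairs `(ψ, η)` with `ψ` in the form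
domain, `η ∈ L²(ℝ)` and `h_ε(ψ, φ) = (η, φ)` for all `φ` in the form domain, where
`(η, φ) = ∫ η φ̄` (Mathlib's inner product is linear in its second argument). -/
noncomputable def perturbedGraph (V : Lp ℂ 1 (volume : Measure ℝ)) (ε : ℝ) :
    Submodule ℂ (L2R × L2R) where
  carrier := {p | p.1 ∈ formDomain V ∧
    ∀ φ ∈ formDomain V, perturbedForm V ε p.1 φ = inner ℂ φ p.2}
  zero_mem' := by
    refine ⟨zero_mem _, fun φ _ => ?_⟩
    have := perturbedForm_smul (V := V) (φ := φ) ε 0 (zero_mem _)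
    simpa using this
  add_mem' := by
    rintro p q ⟨hp, hp'⟩ ⟨hq, hq'⟩
    refine ⟨add_mem hp hq, fun φ hφ => ?_⟩
    rw [Prod.fst_add, Prod.snd_add,
      perturbedForm_add (Lp.aestronglyMeasurable V) ε hp hq hφ, hp' φ hφ, hq' φ hφ, inner_add_right]
  smul_mem' := by
    rintro c p ⟨hp, hp'⟩
    refine ⟨Submodule.smul_mem _ c hp, fun φ hφ => ?_⟩
    rw [Prod.smul_fst, Prod.smul_snd, perturbedForm_smul ε c hp, hp' φ hφ, inner_smul_right]

/-- Smooth compactly supported functions lie in the form domain. -/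
theorem toLp_mem_formDomain (V : Lp ℂ 1 (volume : Measure ℝ)) {u : ℝ → ℝ}
    (hu : ContDiff ℝ ∞ u) (hc : HasCompactSupport u)
    (hL : MemLp (fun x => (u x : ℂ)) 2 (volume : Measure ℝ)) :
    hL.toLp _ ∈ formDomain V := by
  have hd : Continuous (deriv u) := hu.continuous_deriv (by simp)
  have hw := (hasWeakDeriv_of_contDiff u hu).congr hL.coeFn_toLp.symm
  have hm : MemLp (fun x => ((deriv u x : ℝ) : ℂ)) 2 (volume : Measure ℝ) :=
    (Complex.continuous_ofReal.comp hd).memLp_of_hasCompactSupport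
      (hc.deriv.comp_left Complex.ofReal_zero)
  refine ⟨⟨Lp.memLp _, _, hw, hm⟩, ?_⟩
  have hs : MemLp (fun x => (Real.sqrt ‖V x‖ : ℂ)) 2 (volume : Measure ℝ) := by
    have hV : Integrable V (volume : Measure ℝ) := memLp_one_iff_integrable.1 (Lp.memLp V)
    have hm : AEStronglyMeasurable (fun x => (Real.sqrt ‖V x‖ : ℂ)) (volume : Measure ℝ) :=
      (Complex.continuous_ofReal.comp Real.continuous_sqrt).comp_aestronglyMeasurable
        hV.aestronglyMeasurable.norm
    rw [memLp_two_iff_integrable_sq_norm hm]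
    refine hV.norm.congr (Filter.Eventually.of_forall fun x => ?_)
    simp [abs_of_nonneg (Real.sqrt_nonneg _)]
  have hb : MemLp (fun x => (u x : ℂ)) ∞ (volume : Measure ℝ) :=
    (Complex.continuous_ofReal.comp hu.continuous).memLp_of_hasCompactSupport
      (hc.comp_left Complex.ofReal_zero)
  refine (MemLp.mul (p := ∞) (q := 2) (r := 2) hs hb).ae_eq ?_
  filter_upwards [hL.coeFn_toLp] with x hx
  simp [hx, mul_comm]

/-- The graph is single-valued, i.e. it is the graph of an operator. -/
theorem perturbedGraph_single_valued (V : Lp ℂ 1 (volume : Measure ℝ)) (ε : ℝ)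
    (p : L2R × L2R) (hp : p ∈ perturbedGraph V ε) (h0 : p.1 = 0) : p.2 = 0 := by
  obtain ⟨-, hp'⟩ := hp
  have hform : ∀ φ ∈ formDomain V, inner ℂ φ p.2 = 0 := fun φ hφ => by
    rw [← hp' φ hφ, h0]
    have := perturbedForm_smul (V := V) (φ := φ) ε 0 (zero_mem _)
    simpa using this
  rw [Lp.eq_zero_iff_ae_eq_zero]
  refine ae_eq_zero_of_integral_contDiff_smul_eq_zero
    ((Lp.memLp p.2).locallyIntegrable one_le_two) fun u hu hc => ?_
  have hL : MemLp (fun x => (u x : ℂ)) 2 (volume : Measure ℝ) :=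
    (Complex.continuous_ofReal.comp hu.continuous).memLp_of_hasCompactSupport
      (hc.comp_left Complex.ofReal_zero)
  rw [← hform _ (toLp_mem_formDomain V hu hc hL), L2.inner_def]
  refine integral_congr_ae ?_
  filter_upwards [hL.coeFn_toLp] with x hx
  simp [hx, mul_comm]

/-- The operator `H_ε = H ∔ ε V`, `H = -d²/dx² + i sgn(x)`, in `L²(ℝ)`: the operator associated
with the form `h_ε`. -/
noncomputable def perturbedOperator (V : Lp ℂ 1 (volume : Measure ℝ)) (ε : ℝ) :
    L2R →ₗ.[ℂ] L2R :=
  (perturbedGraph V ε).toLinearPMap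

theorem perturbedOperator_graph (V : Lp ℂ 1 (volume : Measure ℝ)) (ε : ℝ) :
    (perturbedOperator V ε).graph = perturbedGraph V ε :=
  Submodule.toLinearPMap_graph_eq _ (perturbedGraph_single_valued V ε)

/-- The point spectrum (set of eigenvalues) of an operator in `L²(ℝ)`. -/
def pointSpectrum (T : L2R →ₗ.[ℂ] L2R) : Set ℂ :=
  {z | ∃ ψ : T.domain, (ψ : L2R) ≠ 0 ∧ T ψ = z • (ψ : L2R)}

/-- The half-strip `[0, ∞) + i (-1, 1)`. -/
def halfStrip : Set ℂ := {z | 0 ≤ z.re ∧ z.im ∈ Ioo (-1 : ℝ) 1}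

/-!
For small `ε` there are no eigenvalues at all. An eigenfunction `F` with eigenvalue `z` is `C¹`, and
on each half-line it solves `F'' = (k² + q) F` with `k² = ± i - z`, `0 ≤ Re k` and `q = ε V`.
Variation of constants gives `F'(0) = -k F(0) + r` (with the reflected equation on the left), where
`(1 + ‖k‖) ‖r‖` is at most a small multiple of `‖F(0)‖`, uniformly in `z`: the term of first order
in `q` is `O(1 / k)` through an integration by parts, which is what `V ∈ W^{1,1}` is for, and the
higher-order terms are controlled by the first moment of `V`. Adding the two boundary relations
bounds `(k₁ + k₂) F(0)`, and since `k₁² - k₂² = 2 i` has modulus `2` whatever `z` is, `F(0) = 0`;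
the bound of `F` by `2 ‖F(0)‖` then gives `F = 0`.
-/

/-! ### Primitives and weak derivatives -/

/-- The function `f` is locally integrable and `F` is one of its primitives on the whole line. -/
structure IsPrimitive {E : Type*} [NormedAddCommGroup E] [NormedSpace ℝ E] (F f : ℝ → E) :
    Prop where
  locallyIntegrable : LocallyIntegrable f
  integral_eq : ∀ a b, ∫ x in a..b, f x = F b - F a

theorem intervalIntegrable_of_locallyIntegrable {E : Type*} [NormedAddCommGroup E] {f : ℝ → E}
    (hf : LocallyIntegrable f) (a b : ℝ) : IntervalIntegrable f volume a b :=
  (hf.integrableOn_isCompact isCompact_uIcc).intervalIntegrable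

namespace IsPrimitive

section NormedSpace

variable {E : Type*} [NormedAddCommGroup E] [NormedSpace ℝ E] {F G f g : ℝ → E}

theorem intervalIntegrable (h : IsPrimitive F f) (a b : ℝ) : IntervalIntegrable f volume a b :=
  intervalIntegrable_of_locallyIntegrable h.locallyIntegrable a b

theorem eq_add_integral (h : IsPrimitive F f) (a x : ℝ) : F x = F a + ∫ y in a..x, f y := by
  rw [h.integral_eq, add_sub_cancel]

theorem continuous (h : IsPrimitive F f) : Continuous F :=
  (continuous_const.add (intervalIntegral.continuous_primitive h.intervalIntegrable 0)).congr
    fun x => (h.eq_add_integral 0 x).symm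

theorem congr_ae (h : IsPrimitive F f) (hfg : f =ᵐ[volume] g) : IsPrimitive F g where
  locallyIntegrable := h.locallyIntegrable.congr hfg
  integral_eq a b := by
    rw [← h.integral_eq, intervalIntegral.integral_congr_ae (hfg.mono fun x hx _ => hx)]

theorem add (hF : IsPrimitive F f) (hG : IsPrimitive G g) :
    IsPrimitive (fun x => F x + G x) fun x => f x + g x where
  locallyIntegrable := hF.locallyIntegrable.add hG.locallyIntegrable
  integral_eq a b := by
    rw [intervalIntegral.integral_add (hF.intervalIntegrable a b) (hG.intervalIntegrable a b),
      hF.integral_eq, hG.integral_eq, add_sub_add_comm]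

theorem smul {𝕜 : Type*} [NormedField 𝕜] [NormedSpace 𝕜 E] [SMulCommClass ℝ 𝕜 E] (c : 𝕜)
    (h : IsPrimitive F f) : IsPrimitive (fun x => c • F x) fun x => c • f x where
  locallyIntegrable := h.locallyIntegrable.smul c
  integral_eq a b := by rw [intervalIntegral.integral_smul, h.integral_eq, smul_sub]

theorem comp_neg (h : IsPrimitive F f) : IsPrimitive (fun x => F (-x)) fun x => -f (-x) where
  locallyIntegrable := by
    refine ((locallyIntegrable_map_homeomorph (Homeomorph.neg ℝ)).1 ?_).neg
    rw [Homeomorph.coe_neg, Measure.map_neg_eq_self]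
    exact h.locallyIntegrable
  integral_eq a b := by
    rw [intervalIntegral.integral_neg, intervalIntegral.integral_comp_neg f, h.integral_eq, neg_sub]

theorem integral (hf : LocallyIntegrable f) (a : ℝ) :
    IsPrimitive (fun x => ∫ y in a..x, f y) f where
  locallyIntegrable := hf
  integral_eq b c := (intervalIntegral.integral_interval_sub_left
    (intervalIntegrable_of_locallyIntegrable hf a c)
    (intervalIntegrable_of_locallyIntegrable hf a b)).symm

theorem absolutelyContinuousOnInterval (h : IsPrimitive F f) (a b : ℝ) :
    AbsolutelyContinuousOnInterval F a b := by
  have hn := (h.intervalIntegrable a b).norm.absolutelyContinuousOnInterval_intervalIntegral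
    (c := a) left_mem_uIcc
  refine squeeze_zero (fun _ => Finset.sum_nonneg fun _ _ => dist_nonneg)
    (fun I => Finset.sum_le_sum fun i _ => ?_) hn
  have hi (x : ℝ) : IntervalIntegrable (fun y => ‖f y‖) volume a x :=
    (h.intervalIntegrable a x).norm
  rw [dist_eq_norm, Real.dist_eq, ← h.integral_eq,
    intervalIntegral.integral_interval_sub_left (hi _) (hi _)]
  exact intervalIntegral.norm_integral_le_abs_integral_norm

variable [CompleteSpace E]

theorem of_hasDerivAt (hF : ∀ x, HasDerivAt F (f x) x) (hf : Continuous f) : IsPrimitive F f where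
  locallyIntegrable := hf.locallyIntegrable
  integral_eq a b :=
    intervalIntegral.integral_eq_sub_of_hasDerivAt (fun x _ => hF x) (hf.intervalIntegrable a b)

theorem ae_hasDerivAt (h : IsPrimitive F f) : ∀ᵐ x, HasDerivAt F (f x) x := by
  filter_upwards [LocallyIntegrable.ae_hasDerivAt_integral h.locallyIntegrable] with x hx
  rw [funext (h.eq_add_integral 0)]
  exact (hx 0).const_add (F 0)

theorem of_ae_hasDerivAt (hf : LocallyIntegrable f)
    (hac : ∀ a b, AbsolutelyContinuousOnInterval F a b) (hd : ∀ᵐ x, HasDerivAt F (f x) x) :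
    IsPrimitive F f where
  locallyIntegrable := hf
  integral_eq a b := by
    have hp := integral hf a
    obtain ⟨c, hc⟩ := ((hac a b).sub (hp.absolutelyContinuousOnInterval a b)
      ).const_of_ae_hasDerivAt_zero <| by
        filter_upwards [hd, hp.ae_hasDerivAt] with x hx hpx _
        simpa only [sub_self] using hx.sub hpx
    have ha := hc a left_mem_uIcc
    have hb := hc b right_mem_uIcc
    simp only [Pi.sub_apply, intervalIntegral.integral_same, sub_zero] at ha hb
    rw [ha, ← hb, sub_sub_cancel]

end NormedSpace

theorem mul {𝕜 : Type*} [RCLike 𝕜] {F G f g : ℝ → 𝕜} (hF : IsPrimitive F f)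
    (hG : IsPrimitive G g) : IsPrimitive (fun x => F x * G x) fun x => f x * G x + F x * g x := by
  refine of_ae_hasDerivAt ?_ (fun a b => ?_) ?_
  · exact (hF.locallyIntegrable.mul_continuous hG.continuous).add
      (hG.locallyIntegrable.continuous_mul hF.continuous)
  · exact (hF.absolutelyContinuousOnInterval a b).smul (hG.absolutelyContinuousOnInterval a b)
  · filter_upwards [hF.ae_hasDerivAt, hG.ae_hasDerivAt] with x hFx hGx using hFx.mul hGx

end IsPrimitive

theorem IsPrimitive.integral_eq_zero_of_hasCompactSupport {E : Type*} [NormedAddCommGroup E]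
    [NormedSpace ℝ E] {F f : ℝ → E} (h : IsPrimitive F f) (hF : HasCompactSupport F)
    (hf : Integrable f) : ∫ x, f x = 0 := by
  have hlim := intervalIntegral_tendsto_integral hf Filter.tendsto_neg_atTop_atBot Filter.tendsto_id
  have h0 := hF.is_zero_at_infty
  rw [cocompact_eq_atBot_atTop, Filter.tendsto_sup] at h0
  refine tendsto_nhds_unique hlim ?_
  simp only [h.integral_eq]
  simpa only [id_eq, sub_zero, Function.comp_def] using
    h0.2.sub (h0.1.comp Filter.tendsto_neg_atTop_atBot)

theorem IsPrimitive.hasWeakDeriv {F f : ℝ → ℂ} (h : IsPrimitive F f) : HasWeakDeriv F f := by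
  refine ⟨h.continuous.locallyIntegrable, h.locallyIntegrable, fun φ hφ hφc => ?_⟩
  have hφ' : Continuous (deriv φ) := hφ.continuous_deriv (by simp)
  have hleib := (of_hasDerivAt (fun x => ((hφ.differentiable (by simp) x).hasDerivAt).ofReal_comp)
    (Complex.continuous_ofReal.comp hφ')).mul h
  have hi₁ : Integrable fun x => deriv φ x • F x :=
    h.continuous.locallyIntegrable.integrable_smul_left_of_hasCompactSupport hφ' hφc.deriv
  have hi₂ : Integrable fun x => φ x • f x :=
    h.locallyIntegrable.integrable_smul_left_of_hasCompactSupport hφ.continuous hφc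
  have h0 := hleib.integral_eq_zero_of_hasCompactSupport
    ((hφc.comp_left Complex.ofReal_zero).mul_right) (hi₁.add hi₂)
  exact eq_neg_of_add_eq_zero_left ((integral_add hi₁ hi₂).symm.trans h0)

theorem exists_hasCompactSupport_deriv_eq {θ : ℝ → ℝ} (hθ : ContDiff ℝ ∞ θ)
    (hc : HasCompactSupport θ) (h0 : ∫ x, θ x = 0) :
    ∃ Θ : ℝ → ℝ, ContDiff ℝ ∞ Θ ∧ HasCompactSupport Θ ∧ deriv Θ = θ := by
  obtain ⟨R, hR⟩ := hc.isCompact.isBounded.subset_ball 0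
  rw [Real.ball_eq_Ioo, zero_sub, zero_add] at hR
  have hz : ∀ x ∉ Ioo (-R) R, θ x = 0 := fun x hx =>
    image_eq_zero_of_notMem_tsupport fun h => hx (hR h)
  have hd (x : ℝ) : HasDerivAt (fun x => ∫ y in (-R)..x, θ y) (θ x) x :=
    hθ.continuous.integral_hasStrictDerivAt (-R) x |>.hasDerivAt
  have hde : deriv (fun x => ∫ y in (-R)..x, θ y) = θ := funext fun x => (hd x).deriv
  refine ⟨fun x => ∫ y in (-R)..x, θ y, ?_, ?_, hde⟩
  · rw [contDiff_infty_iff_deriv, hde]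
    exact ⟨fun x => (hd x).differentiableAt, hθ⟩
  · refine HasCompactSupport.intro (isCompact_Icc (a := -R) (b := R)) fun x hx => ?_
    rcases lt_or_ge x (-R) with hlt | hge
    · refine intervalIntegral.integral_zero_ae (.of_forall fun y hy => ?_)
      rw [uIoc_of_ge hlt.le] at hy
      exact hz y fun hyR => hyR.1.not_ge hy.2
    · have hlt : R < x := lt_of_not_ge fun h => hx ⟨hge, h⟩
      rw [intervalIntegral.integral_of_le hge, ← h0]
      exact setIntegral_eq_integral_of_forall_compl_eq_zero fun y hy =>
        hz y fun hyR => hy ⟨hyR.1, hyR.2.le.trans hlt.le⟩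

theorem ae_eq_const_of_integral_deriv_smul_eq_zero {E : Type*} [NormedAddCommGroup E]
    [NormedSpace ℝ E] [CompleteSpace E] {h : ℝ → E} (hh : LocallyIntegrable h)
    (h0 : ∀ φ : ℝ → ℝ, ContDiff ℝ ∞ φ → HasCompactSupport φ → ∫ x, deriv φ x • h x = 0) :
    ∃ c : E, h =ᵐ[volume] fun _ => c := by
  let β : ContDiffBump (0 : ℝ) := default
  let ρ : ℝ → ℝ := β.normed volume
  have hρ : ContDiff ℝ ∞ ρ := β.contDiff_normed
  have hρc : HasCompactSupport ρ := β.hasCompactSupport_normed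
  have hρi : ∫ x, ρ x = 1 := β.integral_normed
  refine ⟨∫ x, ρ x • h x, ?_⟩
  refine ae_eq_of_integral_contDiff_smul_eq hh (locallyIntegrable_const _) fun φ hφ hφc => ?_
  obtain ⟨Θ, hΘ, hΘc, hΘd⟩ := exists_hasCompactSupport_deriv_eq
    (θ := fun x => φ x - (∫ y, φ y) * ρ x) (hφ.sub (contDiff_const.mul hρ))
    (hφc.sub hρc.mul_left) (by
      rw [integral_sub (hφ.continuous.integrable_of_hasCompactSupport hφc)
        ((hρ.continuous.integrable_of_hasCompactSupport hρc).const_mul _), integral_const_mul,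
        hρi, mul_one, sub_self])
  have hρh : Integrable fun x => (∫ y, φ y) • ρ x • h x :=
    (hh.integrable_smul_left_of_hasCompactSupport hρ.continuous hρc).smul (∫ y, φ y)
  have key := h0 Θ hΘ hΘc
  rw [hΘd] at key
  simp only [sub_smul, mul_smul] at key
  rw [integral_sub (hh.integrable_smul_left_of_hasCompactSupport hφ.continuous hφc) hρh,
    integral_smul, sub_eq_zero] at key
  rw [key, integral_smul_const]

theorem HasWeakDeriv.exists_isPrimitive {f g : ℝ → ℂ} (h : HasWeakDeriv f g) :
    ∃ F, f =ᵐ[volume] F ∧ IsPrimitive F g := by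
  have hG := IsPrimitive.integral h.2.1 0
  have hsub := h.add (hG.hasWeakDeriv.const_smul (-1))
  obtain ⟨c, hc⟩ := ae_eq_const_of_integral_deriv_smul_eq_zero hsub.1 fun φ hφ hφc => by
    rw [hsub.2.2 φ hφ hφc]
    simp
  refine ⟨fun x => c + ∫ y in (0 : ℝ)..x, g y, ?_, h.2.1, fun a b => ?_⟩
  · filter_upwards [hc] with x hx
    rw [← hx]
    simp
  · rw [hG.integral_eq, add_sub_add_left_eq_sub]

/-! ### First-order equations -/

theorem norm_cexp_mul_ofReal_le_one {l : ℂ} {x : ℝ} (h : l.re * x ≤ 0) :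
    ‖Complex.exp (l * x)‖ ≤ 1 := by
  rwa [Complex.norm_exp, Real.exp_le_one_iff, Complex.re_mul_ofReal]

theorem norm_cexp_mul_sub_mul_le {l : ℂ} (hl : 0 ≤ l.re) {a y : ℝ} (hy : y ∈ Ioi a) (z : ℂ) :
    ‖Complex.exp (l * (a - y : ℝ)) * z‖ ≤ ‖z‖ := by
  rw [norm_mul]
  exact mul_le_of_le_one_left (norm_nonneg _) <| norm_cexp_mul_ofReal_le_one <|
    mul_nonpos_of_nonneg_of_nonpos hl (sub_nonpos.2 (le_of_lt hy))

theorem integrableOn_cexp_mul_sub_mul {l : ℂ} (hl : 0 ≤ l.re) {a : ℝ} {g : ℝ → ℂ}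
    (hg : IntegrableOn g (Ioi a)) :
    IntegrableOn (fun y => Complex.exp (l * (a - y : ℝ)) * g y) (Ioi a) :=
  Integrable.mono hg ((by fun_prop : Continuous fun y : ℝ => Complex.exp (l * (a - y : ℝ))
    ).aestronglyMeasurable.mul hg.aestronglyMeasurable) <|
    ae_restrict_of_forall_mem measurableSet_Ioi fun _ hy => norm_cexp_mul_sub_mul_le hl hy _

theorem norm_integral_cexp_mul_sub_mul_le {l : ℂ} (hl : 0 ≤ l.re) {a : ℝ} {g : ℝ → ℂ}
    (hg : IntegrableOn g (Ioi a)) :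
    ‖∫ y in Ioi a, Complex.exp (l * (a - y : ℝ)) * g y‖ ≤ ∫ y in Ioi a, ‖g y‖ :=
  norm_integral_le_of_norm_le hg.norm <|
    ae_restrict_of_forall_mem measurableSet_Ioi fun _ hy => norm_cexp_mul_sub_mul_le hl hy _

theorem eq_zero_of_memLp_Ioi_of_tendsto_atTop {E : Type*} [NormedAddCommGroup E] {f : ℝ → E}
    {p : ℝ≥0∞} (hp₀ : p ≠ 0) (hp : p ≠ ⊤) {a : ℝ} (hf : MemLp f p (volume.restrict (Ioi a))) {c : E}
    (hc : Filter.Tendsto f Filter.atTop (nhds c)) : c = 0 := by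
  have hp' : 0 < p.toReal := ENNReal.toReal_pos hp₀ hp
  have hzero : ‖c‖ ^ p.toReal = 0 :=
    IntegrableAtFilter.eq_zero_of_tendsto (l := Filter.atTop) (μ := volume)
      ⟨Ioi a, Filter.Ioi_mem_atTop a, hf.integrable_norm_rpow hp₀ hp⟩
      (fun s hs => by
        obtain ⟨b, hb⟩ := Filter.mem_atTop_sets.1 hs
        exact measure_mono_top hb Real.volume_Ici)
      (hc.norm.rpow_const (Or.inr hp'.le))
  rwa [Real.rpow_eq_zero (norm_nonneg c) hp'.ne', norm_eq_zero] at hzero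

namespace IsPrimitive

variable {u g : ℝ → ℂ} {l : ℂ}

theorem cexp_mul (h : IsPrimitive u fun x => l * u x + g x) (a : ℝ) :
    IsPrimitive (fun x => Complex.exp (l * (a - x : ℝ)) * u x)
      fun x => Complex.exp (l * (a - x : ℝ)) * g x := by
  have hexp (x : ℝ) : HasDerivAt (fun x : ℝ => Complex.exp (l * (a - x : ℝ)))
      (Complex.exp (l * (a - x : ℝ)) * (l * (-1 : ℝ))) x :=
    ((((hasDerivAt_id x).const_sub a).ofReal_comp).const_mul l).cexp
  refine ((of_hasDerivAt hexp (by fun_prop)).mul h).congr_ae (.of_forall fun x => ?_)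
  push_cast
  ring

theorem norm_sub_cexp_mul_le (h : IsPrimitive u fun x => l * u x + g x) (hl : l.re ≤ 0)
    {a b : ℝ} (hab : a ≤ b) :
    ‖u b - Complex.exp (l * (b - a : ℝ)) * u a‖ ≤ ∫ y in a..b, ‖g y‖ := by
  have hg : LocallyIntegrable g :=
    (h.locallyIntegrable.sub (continuous_const.mul h.continuous).locallyIntegrable).congr
      (.of_forall fun x => add_sub_cancel_left (l * u x) (g x))
  have hduhamel := (h.cexp_mul b).integral_eq a b
  rw [sub_self, Complex.ofReal_zero, mul_zero, Complex.exp_zero, one_mul] at hduhamel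
  rw [← hduhamel]
  refine intervalIntegral.norm_integral_le_of_norm_le hab (.of_forall fun y hy => ?_)
    (intervalIntegrable_of_locallyIntegrable hg a b).norm
  rw [norm_mul]
  exact mul_le_of_le_one_left (norm_nonneg _) <| norm_cexp_mul_ofReal_le_one <|
    mul_nonpos_of_nonpos_of_nonneg hl (sub_nonneg.2 hy.2)

theorem eq_neg_integral_of_memLp (h : IsPrimitive u fun x => l * u x + g x) (hl : 0 ≤ l.re)
    {a : ℝ} (hg : IntegrableOn g (Ioi a)) {p : ℝ≥0∞} (hp₀ : p ≠ 0) (hp : p ≠ ⊤)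
    (hu : MemLp u p (volume.restrict (Ioi a))) :
    u a = -∫ y in Ioi a, Complex.exp (l * (a - y : ℝ)) * g y := by
  have hv := h.cexp_mul a
  have hmem : MemLp (fun x => Complex.exp (l * (a - x : ℝ)) * u x) p (volume.restrict (Ioi a)) :=
    hu.of_le hv.continuous.aestronglyMeasurable <|
      ae_restrict_of_forall_mem measurableSet_Ioi fun _ hx => norm_cexp_mul_sub_mul_le hl hx _
  have hlim := ((intervalIntegral_tendsto_integral_Ioi a
    (integrableOn_cexp_mul_sub_mul hl hg) Filter.tendsto_id).const_add _).congr fun x =>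
      (hv.eq_add_integral a x).symm
  have h0 := eq_zero_of_memLp_Ioi_of_tendsto_atTop hp₀ hp hmem hlim
  rw [sub_self, Complex.ofReal_zero, mul_zero, Complex.exp_zero, one_mul] at h0
  exact eq_neg_of_add_eq_zero_left h0

theorem norm_le_integral_of_memLp (h : IsPrimitive u fun x => l * u x + g x) (hl : 0 ≤ l.re)
    {a : ℝ} (hg : IntegrableOn g (Ioi a)) {p : ℝ≥0∞} (hp₀ : p ≠ 0) (hp : p ≠ ⊤)
    (hu : MemLp u p (volume.restrict (Ioi a))) : ‖u a‖ ≤ ∫ y in Ioi a, ‖g y‖ := by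
  rw [h.eq_neg_integral_of_memLp hl hg hp₀ hp hu, norm_neg]
  exact norm_integral_cexp_mul_sub_mul_le hl hg

theorem norm_mul_integral_cexp_mul_le (h : IsPrimitive u g) (hl : 0 ≤ l.re) {a : ℝ}
    (hu : IntegrableOn u (Ioi a)) (hg : IntegrableOn g (Ioi a)) :
    ‖l * ∫ y in Ioi a, Complex.exp (l * (a - y : ℝ)) * u y‖ ≤ 2 * ∫ y in Ioi a, ‖g y‖ := by
  have hu₁ : MemLp u 1 (volume.restrict (Ioi a)) := memLp_one_iff_integrable.2 hu
  have hua : ‖u a‖ ≤ ∫ y in Ioi a, ‖g y‖ :=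
    IsPrimitive.norm_le_integral_of_memLp (l := 0) (by simpa using h) le_rfl hg one_ne_zero
      ENNReal.one_ne_top hu₁
  have hparts : l * ∫ y in Ioi a, Complex.exp (l * (a - y : ℝ)) * u y =
      u a + ∫ y in Ioi a, Complex.exp (l * (a - y : ℝ)) * g y := by
    have heq := IsPrimitive.eq_neg_integral_of_memLp (l := l) (g := fun x => g x - l * u x)
      (by simpa using h) hl (hg.sub (hu.const_mul l)) one_ne_zero ENNReal.one_ne_top hu₁
    simp only [mul_sub, mul_left_comm _ l] at heq
    rw [integral_sub (integrableOn_cexp_mul_sub_mul hl hg)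
      ((integrableOn_cexp_mul_sub_mul hl hu).const_mul l), integral_const_mul] at heq
    linear_combination -heq
  calc ‖l * ∫ y in Ioi a, Complex.exp (l * (a - y : ℝ)) * u y‖
      ≤ ‖u a‖ + ‖∫ y in Ioi a, Complex.exp (l * (a - y : ℝ)) * g y‖ := hparts ▸ norm_add_le _ _
    _ ≤ 2 * ∫ y in Ioi a, ‖g y‖ := by
      linarith [norm_integral_cexp_mul_sub_mul_le hl hg]

end IsPrimitive

theorem IsPrimitive.exists_forall_norm_le_of_memLp {F P : ℝ → ℂ} (h : IsPrimitive F P) {a : ℝ}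
    (hF : MemLp F 2 (volume.restrict (Ioi a))) (hP : MemLp P 2 (volume.restrict (Ioi a))) :
    ∃ S, ∀ x, a ≤ x → ‖F x‖ ≤ S := by
  have hsq : IntegrableOn (fun x => P x * F x + F x * P x) (Ioi a) :=
    (hP.integrable_mul hF).add (hF.integrable_mul hP)
  refine ⟨√(‖F a * F a‖ + ∫ y in Ioi a, ‖P y * F y + F y * P y‖), fun x hx =>
    Real.le_sqrt_of_sq_le ?_⟩
  rw [sq, ← norm_mul, (h.mul h).eq_add_integral a x]
  refine (norm_add_le _ _).trans (add_le_add_right ?_ _)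
  exact (intervalIntegral.norm_integral_le_integral_norm hx).trans <| by
    rw [intervalIntegral.integral_of_le hx]
    exact setIntegral_mono_set hsq.norm (.of_forall fun _ => norm_nonneg _)
      Ioc_subset_Ioi_self.eventuallyLE

/-! ### Square integrable solutions on a half-line -/

/-- The solution `E` of `E' = 1 - 2 k E`, `E 0 = 0`; the homogeneous equation `F'' = k² F` has the
solutions `exp (-k x)` and `exp (k x) E x`, and this second form makes sense for `k = 0` too. -/
noncomputable def expPrimitive (k : ℂ) (x : ℝ) : ℂ :=
  ∫ y in (0 : ℝ)..x, Complex.exp (-(2 * k) * y)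

theorem expPrimitive_zero (k : ℂ) : expPrimitive k 0 = 0 :=
  intervalIntegral.integral_same

theorem two_mul_mul_expPrimitive (k : ℂ) (x : ℝ) :
    2 * k * expPrimitive k x = 1 - Complex.exp (-(2 * k) * x) := by
  have hd (y : ℝ) : HasDerivAt (fun y : ℝ => Complex.exp (-(2 * k) * y))
      (Complex.exp (-(2 * k) * y) * (-(2 * k) * (1 : ℝ))) y :=
    (((hasDerivAt_id y).ofReal_comp).const_mul _).cexp
  have h := (IsPrimitive.of_hasDerivAt hd (by fun_prop)).integral_eq 0 x
  rw [intervalIntegral.integral_mul_const, Complex.ofReal_zero, mul_zero, Complex.exp_zero] at h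
  rw [expPrimitive]
  push_cast at h
  linear_combination -h

theorem isPrimitive_expPrimitive (k : ℂ) :
    IsPrimitive (expPrimitive k) fun x => 1 - 2 * k * expPrimitive k x := by
  simp only [two_mul_mul_expPrimitive, sub_sub_cancel]
  exact IsPrimitive.integral (by fun_prop : Continuous _).locallyIntegrable 0

section

variable {k : ℂ} (hk : 0 ≤ k.re) {x : ℝ} (hx : 0 ≤ x)

include hk hx

theorem norm_cexp_neg_two_mul_le_one : ‖Complex.exp (-(2 * k) * x)‖ ≤ 1 :=
  norm_cexp_mul_ofReal_le_one <| mul_nonpos_of_nonpos_of_nonneg (by simpa using hk) hx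

theorem norm_expPrimitive_le : ‖expPrimitive k x‖ ≤ x := by
  refine (intervalIntegral.norm_integral_le_of_norm_le_const (C := 1) fun y hy => ?_).trans_eq ?_
  · rw [uIoc_of_le hx] at hy
    exact norm_cexp_neg_two_mul_le_one hk hy.1.le
  · rw [one_mul, sub_zero, abs_of_nonneg hx]

theorem norm_mul_expPrimitive_le : ‖k * expPrimitive k x‖ ≤ 1 := by
  have h : ‖(2 : ℂ) * (k * expPrimitive k x)‖ ≤ 1 + 1 := by
    rw [← mul_assoc, two_mul_mul_expPrimitive]
    exact (norm_sub_le _ _).trans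
      (add_le_add norm_one.le (norm_cexp_neg_two_mul_le_one hk hx))
  rw [norm_mul, Complex.norm_ofNat] at h
  linarith

end

/-- `F` is a solution, with derivative `P`, of `F'' = (k² + q) F` for which `F` and `F'` are square
integrable at `+∞`. Only the values of `q` on `(0, ∞)` are subject to a condition. -/
structure IsDecayingSolution (k : ℂ) (q F P : ℝ → ℂ) : Prop where
  re_nonneg : 0 ≤ k.re
  isPrimitive_fst : IsPrimitive F P
  isPrimitive_snd : IsPrimitive P fun x => (k ^ 2 + q x) * F x
  memLp_fst : MemLp F 2 (volume.restrict (Ioi 0))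
  memLp_snd : MemLp P 2 (volume.restrict (Ioi 0))
  integrableOn : IntegrableOn q (Ioi 0)

namespace IsDecayingSolution

variable {k : ℂ} {q F P : ℝ → ℂ}

theorem exists_forall_norm_le (h : IsDecayingSolution k q F P) : ∃ S, ∀ x, 0 ≤ x → ‖F x‖ ≤ S :=
  h.isPrimitive_fst.exists_forall_norm_le_of_memLp h.memLp_fst h.memLp_snd

theorem aestronglyMeasurable_fst (h : IsDecayingSolution k q F P) :
    AEStronglyMeasurable F (volume.restrict (Ioi 0)) :=
  h.isPrimitive_fst.continuous.aestronglyMeasurable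

theorem integrableOn_mul (h : IsDecayingSolution k q F P) :
    IntegrableOn (fun x => q x * F x) (Ioi 0) := by
  obtain ⟨S, hS⟩ := h.exists_forall_norm_le
  exact h.integrableOn.mul_bdd h.aestronglyMeasurable_fst
    (ae_restrict_of_forall_mem measurableSet_Ioi fun x hx => hS x (le_of_lt hx))

theorem isPrimitive_snd_add (h : IsDecayingSolution k q F P) :
    IsPrimitive (fun x => P x + k * F x) fun x => k * (P x + k * F x) + q x * F x :=
  (h.isPrimitive_snd.add (h.isPrimitive_fst.smul k)).congr_ae <| .of_forall fun x => by
    simp only [smul_eq_mul]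
    ring

theorem memLp_snd_add (h : IsDecayingSolution k q F P) :
    MemLp (fun x => P x + k * F x) 2 (volume.restrict (Ioi 0)) :=
  h.memLp_snd.add (h.memLp_fst.const_mul k)

theorem snd_add_zero_eq (h : IsDecayingSolution k q F P) :
    P 0 + k * F 0 = -∫ y in Ioi (0 : ℝ), Complex.exp (-k * y) * (q y * F y) := by
  simpa using h.isPrimitive_snd_add.eq_neg_integral_of_memLp h.re_nonneg h.integrableOn_mul
    two_ne_zero ENNReal.ofNat_ne_top h.memLp_snd_add

theorem norm_snd_add_le (h : IsDecayingSolution k q F P) {x : ℝ} (hx : 0 ≤ x) :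
    ‖P x + k * F x‖ ≤ ∫ y in Ioi x, ‖q y * F y‖ :=
  h.isPrimitive_snd_add.norm_le_integral_of_memLp h.re_nonneg
    (h.integrableOn_mul.mono_set (Ioi_subset_Ioi hx)) two_ne_zero ENNReal.ofNat_ne_top
    (h.memLp_snd_add.mono_measure (Measure.restrict_mono (Ioi_subset_Ioi hx) le_rfl))

theorem isPrimitive_sub_expPrimitive_mul (h : IsDecayingSolution k q F P) :
    IsPrimitive (fun x => F x - expPrimitive k x * (P x + k * F x)) fun x =>
      -k * (F x - expPrimitive k x * (P x + k * F x)) + -(expPrimitive k x * (q x * F x)) := by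
  have hEA := ((isPrimitive_expPrimitive k).mul h.isPrimitive_snd_add).smul (-1 : ℂ)
  simpa only [smul_eq_mul, neg_one_mul, ← sub_eq_add_neg] using
    (h.isPrimitive_fst.add hEA).congr_ae <| .of_forall fun x => by
      simp only [smul_eq_mul]
      ring

theorem norm_sub_cexp_mul_le (h : IsDecayingSolution k q F P) {x : ℝ} (hx : 0 ≤ x) :
    ‖F x - Complex.exp (-k * x) * F 0‖ ≤ ‖expPrimitive k x‖ * (∫ y in Ioi x, ‖q y * F y‖) +
      ∫ y in (0 : ℝ)..x, ‖expPrimitive k y‖ * ‖q y * F y‖ := by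
  have hG := h.isPrimitive_sub_expPrimitive_mul.norm_sub_cexp_mul_le
    (by simpa using h.re_nonneg) hx
  simp only [expPrimitive_zero, zero_mul, sub_zero, norm_neg, norm_mul (expPrimitive k _)] at hG
  calc ‖F x - Complex.exp (-k * x) * F 0‖
      = ‖expPrimitive k x * (P x + k * F x) +
        (F x - expPrimitive k x * (P x + k * F x) - Complex.exp (-k * x) * F 0)‖ := by
        congr 1
        ring
    _ ≤ _ := (norm_add_le _ _).trans <| add_le_add (by
        rw [norm_mul]
        exact mul_le_mul_of_nonneg_left (h.norm_snd_add_le hx) (norm_nonneg _)) hG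

theorem norm_mul_norm_sub_cexp_mul_le (h : IsDecayingSolution k q F P) {c : ℂ} {B : ℝ → ℝ}
    (hB : MonotoneOn B (Ici 0)) (hcB : ∀ x, 0 ≤ x → ‖c * expPrimitive k x‖ ≤ B x)
    (hBqF : IntegrableOn (fun x => B x * ‖q x * F x‖) (Ioi 0)) {x : ℝ} (hx : 0 ≤ x) :
    ‖c‖ * ‖F x - Complex.exp (-k * x) * F 0‖ ≤ ∫ y in Ioi 0, B y * ‖q y * F y‖ := by
  have htail : ‖c‖ * (‖expPrimitive k x‖ * ∫ y in Ioi x, ‖q y * F y‖) ≤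
      ∫ y in Ioi x, B y * ‖q y * F y‖ := by
    rw [← mul_assoc, ← norm_mul, ← integral_const_mul]
    refine integral_mono_of_nonneg (.of_forall fun y => by positivity)
      (hBqF.mono_set (Ioi_subset_Ioi hx))
      (ae_restrict_of_forall_mem measurableSet_Ioi fun y hy => ?_)
    exact mul_le_mul_of_nonneg_right
      ((hcB x hx).trans (hB hx (hx.trans (le_of_lt hy)) (le_of_lt hy))) (norm_nonneg _)
  have hhead : ‖c‖ * (∫ y in (0 : ℝ)..x, ‖expPrimitive k y‖ * ‖q y * F y‖) ≤
      ∫ y in (0 : ℝ)..x, B y * ‖q y * F y‖ := by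
    rw [intervalIntegral.integral_of_le hx, intervalIntegral.integral_of_le hx,
      ← integral_const_mul]
    refine integral_mono_of_nonneg (.of_forall fun y => by positivity)
      (hBqF.mono_set Ioc_subset_Ioi_self)
      (ae_restrict_of_forall_mem measurableSet_Ioc fun y hy => ?_)
    simp only [← mul_assoc, ← norm_mul c]
    exact mul_le_mul_of_nonneg_right (hcB y hy.1.le) (norm_nonneg _)
  refine (mul_le_mul_of_nonneg_left (h.norm_sub_cexp_mul_le hx) (norm_nonneg c)).trans ?_
  rw [mul_add, add_comm, ← intervalIntegral.integral_interval_add_Ioi hBqF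
    (hBqF.mono_set (Ioi_subset_Ioi hx))]
  exact add_le_add hhead htail

theorem norm_mul_norm_sub_cexp_mul_le_of_norm_le (h : IsDecayingSolution k q F P) {c : ℂ}
    {B : ℝ → ℝ} (hB : MonotoneOn B (Ici 0)) (hcB : ∀ x, 0 ≤ x → ‖c * expPrimitive k x‖ ≤ B x)
    (hBq : IntegrableOn (fun x => B x * ‖q x‖) (Ioi 0)) {S : ℝ} (hS : ∀ x, 0 ≤ x → ‖F x‖ ≤ S)
    {x : ℝ} (hx : 0 ≤ x) :
    ‖c‖ * ‖F x - Complex.exp (-k * x) * F 0‖ ≤ (∫ y in Ioi 0, B y * ‖q y‖) * S := by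
  have hBqF : IntegrableOn (fun y => B y * ‖q y * F y‖) (Ioi 0) := by
    simp only [norm_mul, ← mul_assoc]
    exact hBq.mul_bdd h.aestronglyMeasurable_fst.norm
      (ae_restrict_of_forall_mem measurableSet_Ioi fun y hy => by
        simpa using hS y (le_of_lt hy))
  calc ‖c‖ * ‖F x - Complex.exp (-k * x) * F 0‖
      ≤ ∫ y in Ioi 0, B y * ‖q y * F y‖ := h.norm_mul_norm_sub_cexp_mul_le hB hcB hBqF hx
    _ ≤ ∫ y in Ioi 0, B y * ‖q y‖ * S := by
        refine setIntegral_mono_on hBqF (hBq.mul_const S) measurableSet_Ioi fun y hy => ?_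
        rw [norm_mul, ← mul_assoc]
        have hB_nonneg := (norm_nonneg _).trans (hcB y (le_of_lt hy))
        gcongr
        exact hS y (le_of_lt hy)
    _ = (∫ y in Ioi 0, B y * ‖q y‖) * S := integral_mul_const _ _

theorem norm_sub_cexp_mul_le_moment (h : IsDecayingSolution k q F P)
    (hmom : IntegrableOn (fun x => x * ‖q x‖) (Ioi 0)) {S : ℝ} (hS : ∀ x, 0 ≤ x → ‖F x‖ ≤ S)
    {x : ℝ} (hx : 0 ≤ x) :
    ‖F x - Complex.exp (-k * x) * F 0‖ ≤ (∫ y in Ioi 0, y * ‖q y‖) * S := by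
  simpa using h.norm_mul_norm_sub_cexp_mul_le_of_norm_le (c := 1) (monotone_id.monotoneOn _)
    (fun x hx => by simpa using norm_expPrimitive_le h.re_nonneg hx) hmom hS hx

theorem norm_mul_norm_sub_cexp_mul_le_integral (h : IsDecayingSolution k q F P) {S : ℝ}
    (hS : ∀ x, 0 ≤ x → ‖F x‖ ≤ S) {x : ℝ} (hx : 0 ≤ x) :
    ‖k‖ * ‖F x - Complex.exp (-k * x) * F 0‖ ≤ (∫ y in Ioi 0, ‖q y‖) * S := by
  simpa using h.norm_mul_norm_sub_cexp_mul_le_of_norm_le (c := k) (B := fun _ => 1) monotoneOn_const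
    (fun x hx => norm_mul_expPrimitive_le h.re_nonneg hx) (by simpa using! h.integrableOn.norm)
    hS hx

theorem norm_cexp_mul_le_one (h : IsDecayingSolution k q F P) {x : ℝ} (hx : 0 ≤ x) :
    ‖Complex.exp (-k * x)‖ ≤ 1 :=
  norm_cexp_mul_ofReal_le_one <|
    mul_nonpos_of_nonpos_of_nonneg (by simpa using h.re_nonneg) hx

theorem norm_le_two_mul (h : IsDecayingSolution k q F P)
    (hmom : IntegrableOn (fun x => x * ‖q x‖) (Ioi 0))
    (hsmall : ∫ x in Ioi 0, x * ‖q x‖ ≤ 1 / 2) {x : ℝ} (hx : 0 ≤ x) : ‖F x‖ ≤ 2 * ‖F 0‖ := by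
  obtain ⟨S₀, hS₀⟩ := h.exists_forall_norm_le
  obtain ⟨S, hS⟩ : ∃ S, IsLUB ((fun x => ‖F x‖) '' Ici 0) S :=
    Real.exists_isLUB (nonempty_Ici.image _) ⟨S₀, forall_mem_image.2 hS₀⟩
  have hFS : ∀ x, 0 ≤ x → ‖F x‖ ≤ S := fun x hx => hS.1 (mem_image_of_mem _ hx)
  have hS_nonneg : 0 ≤ S := (norm_nonneg _).trans (hFS 0 le_rfl)
  have hS_le : S ≤ ‖F 0‖ + 1 / 2 * S := hS.2 <| forall_mem_image.2 fun y hy => by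
    have hdev := h.norm_sub_cexp_mul_le_moment hmom hFS hy
    calc ‖F y‖ ≤ ‖Complex.exp (-k * y) * F 0‖ + ‖F y - Complex.exp (-k * y) * F 0‖ :=
          norm_le_norm_add_norm_sub' _ _
      _ ≤ ‖F 0‖ + 1 / 2 * S := by
        rw [norm_mul]
        exact add_le_add (mul_le_of_le_one_left (norm_nonneg _) (h.norm_cexp_mul_le_one hy))
          (hdev.trans (mul_le_mul_of_nonneg_right hsmall hS_nonneg))
  linarith [hFS x hx]

/- The first integral is the Born approximation: integration by parts shows that it is `O(1 / k)`,
whereas the estimate by the norm of `q` is not enough for large `k`. -/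
theorem snd_add_zero_eq_born (h : IsDecayingSolution k q F P) :
    P 0 + k * F 0 = -((∫ y in Ioi (0 : ℝ), Complex.exp (-(2 * k) * y) * q y) * F 0) -
      ∫ y in Ioi (0 : ℝ), Complex.exp (-k * y) * (q y * (F y - Complex.exp (-k * y) * F 0)) := by
  have hiqF : IntegrableOn (fun y : ℝ => Complex.exp (-k * y) * (q y * F y)) (Ioi 0) := by
    simpa using integrableOn_cexp_mul_sub_mul h.re_nonneg h.integrableOn_mul
  have hiq : IntegrableOn (fun y : ℝ => Complex.exp (-(2 * k) * y) * q y) (Ioi 0) := by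
    simpa using integrableOn_cexp_mul_sub_mul (l := 2 * k) (by simpa using h.re_nonneg)
      h.integrableOn
  have hexp (y : ℝ) :
      Complex.exp (-(2 * k) * y) = Complex.exp (-k * y) * Complex.exp (-k * y) := by
    rw [← Complex.exp_add]
    congr 1
    ring
  rw [h.snd_add_zero_eq, ← integral_mul_const, sub_eq_add_neg, ← neg_add,
    ← integral_add (hiq.mul_const _)]
  · congr 2 with y
    rw [hexp]
    ring
  · refine (hiqF.sub (hiq.mul_const (F 0))).congr (.of_forall fun y => ?_)
    simp only [hexp, Pi.sub_apply]
    ring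

section Boundary

variable (h : IsDecayingSolution k q F P) (hmom : IntegrableOn (fun x => x * ‖q x‖) (Ioi 0))
  (hsmall : ∫ x in Ioi 0, x * ‖q x‖ ≤ 1 / 2)

include h hmom hsmall

theorem norm_snd_add_zero_le :
    ‖P 0 + k * F 0‖ ≤ 2 * (∫ y in Ioi 0, ‖q y‖) * ‖F 0‖ :=
  calc ‖P 0 + k * F 0‖ ≤ ∫ y in Ioi 0, ‖q y * F y‖ := h.norm_snd_add_le le_rfl
    _ ≤ ∫ y in Ioi 0, ‖q y‖ * (2 * ‖F 0‖) := by
      refine setIntegral_mono_on h.integrableOn_mul.norm (h.integrableOn.norm.mul_const _)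
        measurableSet_Ioi fun y hy => ?_
      rw [norm_mul]
      exact mul_le_mul_of_nonneg_left (h.norm_le_two_mul hmom hsmall (le_of_lt hy)) (norm_nonneg _)
    _ = 2 * (∫ y in Ioi 0, ‖q y‖) * ‖F 0‖ := by
      rw [integral_mul_const]
      ring

theorem norm_mul_norm_integral_cexp_mul_sub_le :
    ‖k‖ * ‖∫ y in Ioi (0 : ℝ),
        Complex.exp (-k * y) * (q y * (F y - Complex.exp (-k * y) * F 0))‖ ≤
      2 * (∫ y in Ioi 0, ‖q y‖) ^ 2 * ‖F 0‖ := by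
  rw [← norm_mul, ← integral_const_mul]
  calc _ ≤ ∫ y in Ioi 0, ‖q y‖ * ((∫ y in Ioi 0, ‖q y‖) * (2 * ‖F 0‖)) := by
        refine norm_integral_le_of_norm_le (h.integrableOn.norm.mul_const _)
          (ae_restrict_of_forall_mem measurableSet_Ioi fun y hy => ?_)
        have hdev := h.norm_mul_norm_sub_cexp_mul_le_integral
          (fun x hx => h.norm_le_two_mul hmom hsmall hx) (le_of_lt hy)
        simp only [norm_mul k, norm_mul (Complex.exp (-k * y)), norm_mul (q y)]
        calc _ = ‖Complex.exp (-k * y)‖ *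
              (‖q y‖ * (‖k‖ * ‖F y - Complex.exp (-k * y) * F 0‖)) := by ring
          _ ≤ 1 * (‖q y‖ * ((∫ y in Ioi 0, ‖q y‖) * (2 * ‖F 0‖))) := by
            gcongr
            exact h.norm_cexp_mul_le_one (le_of_lt hy)
          _ = _ := one_mul _
    _ = _ := by
      rw [integral_mul_const]
      ring

theorem norm_mul_norm_snd_add_zero_le {w w' : ℝ → ℂ} (hqw : EqOn q w (Ioi 0))
    (hw : IsPrimitive w w') (hw' : IntegrableOn w' (Ioi 0)) :
    ‖k‖ * ‖P 0 + k * F 0‖ ≤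
      ((∫ y in Ioi 0, ‖w' y‖) + 2 * (∫ y in Ioi 0, ‖q y‖) ^ 2) * ‖F 0‖ := by
  set B := ∫ y in Ioi (0 : ℝ), Complex.exp (-(2 * k) * y) * q y with hB
  set D := ∫ y in Ioi (0 : ℝ),
    Complex.exp (-k * y) * (q y * (F y - Complex.exp (-k * y) * F 0)) with hD
  have hborn : ‖k‖ * ‖B‖ ≤ ∫ y in Ioi 0, ‖w' y‖ := by
    have hbound := hw.norm_mul_integral_cexp_mul_le (l := 2 * k) (by simpa using h.re_nonneg)
      (h.integrableOn.congr_fun hqw measurableSet_Ioi) hw'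
    have hBw : B = ∫ y in Ioi (0 : ℝ), Complex.exp (2 * k * (0 - y : ℝ)) * w y :=
      setIntegral_congr_fun measurableSet_Ioi fun y hy => by simp [hqw hy]
    rw [← hBw, norm_mul, norm_mul, Complex.norm_ofNat, mul_assoc] at hbound
    linarith
  have hdev : ‖k‖ * ‖D‖ ≤ 2 * (∫ y in Ioi 0, ‖q y‖) ^ 2 * ‖F 0‖ :=
    h.norm_mul_norm_integral_cexp_mul_sub_le hmom hsmall
  calc ‖k‖ * ‖P 0 + k * F 0‖ ≤ ‖k‖ * (‖B‖ * ‖F 0‖ + ‖D‖) := by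
        rw [h.snd_add_zero_eq_born, ← hB, ← hD, ← neg_mul]
        refine mul_le_mul_of_nonneg_left ((norm_sub_le _ _).trans_eq ?_) (norm_nonneg k)
        rw [norm_mul, norm_neg]
    _ = ‖k‖ * ‖B‖ * ‖F 0‖ + ‖k‖ * ‖D‖ := by ring
    _ ≤ _ := by
      rw [add_mul]
      exact add_le_add (mul_le_mul_of_nonneg_right hborn (norm_nonneg _)) hdev

theorem one_add_norm_mul_norm_snd_add_zero_le {w w' : ℝ → ℂ} (hqw : EqOn q w (Ioi 0))
    (hw : IsPrimitive w w') (hw' : IntegrableOn w' (Ioi 0)) (hq : ∫ y in Ioi 0, ‖q y‖ ≤ 1) :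
    (1 + ‖k‖) * ‖P 0 + k * F 0‖ ≤
      (4 * (∫ y in Ioi 0, ‖q y‖) + ∫ y in Ioi 0, ‖w' y‖) * ‖F 0‖ := by
  have hlow := h.norm_snd_add_zero_le hmom hsmall
  have hhigh := h.norm_mul_norm_snd_add_zero_le hmom hsmall hqw hw hw'
  have hq₀ : 0 ≤ ∫ y in Ioi 0, ‖q y‖ := integral_nonneg fun _ => norm_nonneg _
  have hsq : (∫ y in Ioi 0, ‖q y‖) ^ 2 * ‖F 0‖ ≤ (∫ y in Ioi 0, ‖q y‖) * ‖F 0‖ :=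
    mul_le_mul_of_nonneg_right (pow_le_of_le_one hq₀ hq two_ne_zero) (norm_nonneg _)
  linarith

end Boundary

end IsDecayingSolution

/-! ### Matching at the origin -/

/-- The density of the weighted `W^{1,1}` norm of a function `w` with derivative `w'`. The potential
`w` creates no eigenvalue if the integral of this density is small. The factor `4` comes from the
boundary estimate `IsDecayingSolution.one_add_norm_mul_norm_snd_add_zero_le`. -/
noncomputable def sobolevDensity (w w' : ℝ → ℂ) (x : ℝ) : ℝ :=
  (4 + |x|) * ‖w x‖ + ‖w' x‖

section

variable {w w' : ℝ → ℂ} {x : ℝ}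

theorem four_mul_norm_add_norm_le_sobolevDensity : 4 * ‖w x‖ + ‖w' x‖ ≤ sobolevDensity w w' x := by
  rw [sobolevDensity]
  gcongr
  exact le_add_of_nonneg_right (abs_nonneg x)

theorem abs_mul_norm_le_sobolevDensity : |x| * ‖w x‖ ≤ sobolevDensity w w' x :=
  (mul_le_mul_of_nonneg_right (le_add_of_nonneg_left zero_le_four) (norm_nonneg _)).trans
    (le_add_of_nonneg_right (norm_nonneg _))

theorem sobolevDensity_nonneg : 0 ≤ sobolevDensity w w' x := by
  rw [sobolevDensity]
  positivity

theorem sobolevDensity_comp_neg :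
    sobolevDensity (fun x => w (-x)) (fun x => -w' (-x)) x = sobolevDensity w w' (-x) := by
  simp only [sobolevDensity, abs_neg, norm_neg]

theorem sobolevDensity_const_mul (c : ℂ) :
    sobolevDensity (fun x => c * w x) (fun x => c * w' x) x = ‖c‖ * sobolevDensity w w' x := by
  simp only [sobolevDensity, norm_mul]
  ring

theorem integrable_sobolevDensity (hw : Integrable w) (hmom : Integrable fun x => x * ‖w x‖)
    (hw' : Integrable w') : Integrable (sobolevDensity w w') := by
  refine (((hw.norm.const_mul 4).add hmom.norm).add hw'.norm).congr (.of_forall fun x => ?_)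
  simp only [sobolevDensity, Pi.add_apply, norm_mul, Real.norm_eq_abs, abs_norm, add_mul]

theorem IsPrimitive.integrableOn_of_sobolevDensity (hw : IsPrimitive w w') {s : Set ℝ}
    (hint : IntegrableOn (sobolevDensity w w') s) :
    IntegrableOn w s ∧ IntegrableOn w' s := by
  refine ⟨Integrable.mono' hint hw.continuous.aestronglyMeasurable (.of_forall fun x => ?_),
    Integrable.mono' hint hw.locallyIntegrable.aestronglyMeasurable.restrict
      (.of_forall fun x => ?_)⟩ <;>
  linarith [four_mul_norm_add_norm_le_sobolevDensity (w := w) (w' := w') (x := x),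
    norm_nonneg (w x), norm_nonneg (w' x)]

end

section HalfLine

variable {k : ℂ} {q F P w w' : ℝ → ℂ} (h : IsDecayingSolution k q F P) (hqw : EqOn q w (Ioi 0))
  (hw : IsPrimitive w w') (hint : IntegrableOn (sobolevDensity w w') (Ioi 0))
  (hsmall : ∫ x in Ioi 0, sobolevDensity w w' x ≤ 1 / 2)

include hqw hw hint in
theorem integrableOn_mul_norm_of_sobolevDensity : IntegrableOn (fun x => x * ‖q x‖) (Ioi 0) := by
  have hqm := (hw.continuous.aestronglyMeasurable (μ := volume.restrict (Ioi 0))).congr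
    (ae_restrict_of_forall_mem measurableSet_Ioi fun x hx => (hqw hx).symm)
  refine Integrable.mono' hint (aestronglyMeasurable_id.mul hqm.norm)
    (ae_restrict_of_forall_mem measurableSet_Ioi fun x hx => ?_)
  rw [norm_mul, norm_norm, Real.norm_eq_abs, hqw hx]
  exact abs_mul_norm_le_sobolevDensity

include hqw hw hint hsmall

theorem integral_mul_norm_le_half : ∫ x in Ioi 0, x * ‖q x‖ ≤ 1 / 2 := by
  refine (setIntegral_mono_on (integrableOn_mul_norm_of_sobolevDensity hqw hw hint) hint
    measurableSet_Ioi fun x hx => ?_).trans hsmall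
  rw [hqw hx]
  exact (mul_le_mul_of_nonneg_right (le_abs_self x) (norm_nonneg _)).trans
    abs_mul_norm_le_sobolevDensity

include h

theorem IsDecayingSolution.norm_le_two_mul_of_sobolevDensity {x : ℝ} (hx : 0 ≤ x) :
    ‖F x‖ ≤ 2 * ‖F 0‖ :=
  h.norm_le_two_mul (integrableOn_mul_norm_of_sobolevDensity hqw hw hint)
    (integral_mul_norm_le_half hqw hw hint hsmall) hx

theorem IsDecayingSolution.one_add_norm_mul_norm_snd_add_zero_le_sobolevDensity :
    (1 + ‖k‖) * ‖P 0 + k * F 0‖ ≤ (∫ x in Ioi 0, sobolevDensity w w' x) * ‖F 0‖ := by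
  obtain ⟨hwi, hwi'⟩ := hw.integrableOn_of_sobolevDensity hint
  have hnorm : ∫ x in Ioi 0, ‖q x‖ = ∫ x in Ioi 0, ‖w x‖ :=
    setIntegral_congr_fun measurableSet_Ioi fun x hx => by simp only [hqw hx]
  have htotal : 4 * (∫ x in Ioi 0, ‖q x‖) + ∫ x in Ioi 0, ‖w' x‖ ≤
      ∫ x in Ioi 0, sobolevDensity w w' x := by
    rw [hnorm, ← integral_const_mul, ← integral_add (hwi.norm.const_mul 4) hwi'.norm]
    exact integral_mono ((hwi.norm.const_mul 4).add hwi'.norm) hint fun x =>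
      four_mul_norm_add_norm_le_sobolevDensity
  have hw'_nonneg : 0 ≤ ∫ x in Ioi 0, ‖w' x‖ := integral_nonneg fun _ => norm_nonneg _
  refine (h.one_add_norm_mul_norm_snd_add_zero_le
    (integrableOn_mul_norm_of_sobolevDensity hqw hw hint)
    (integral_mul_norm_le_half hqw hw hint hsmall) hqw hw hwi' (by linarith)).trans ?_
  exact mul_le_mul_of_nonneg_right htotal (norm_nonneg _)

end HalfLine

theorem eq_zero_of_norm_boundary_le {k₁ k₂ f p : ℂ} {β₁ β₂ : ℝ} (hk : ‖k₁ ^ 2 - k₂ ^ 2‖ = 2)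
    (h₁ : (1 + ‖k₁‖) * ‖p + k₁ * f‖ ≤ β₁ * ‖f‖) (h₂ : (1 + ‖k₂‖) * ‖-p + k₂ * f‖ ≤ β₂ * ‖f‖)
    (hβ : β₁ + β₂ < 1) : f = 0 := by
  have hnorm_le {a b : ℂ} (hab : ‖a ^ 2 - b ^ 2‖ = 2) : ‖a‖ ≤ ‖b‖ + 2 := by
    have hsq := norm_le_norm_add_norm_sub' (a ^ 2) (b ^ 2)
    rw [hab, norm_pow, norm_pow] at hsq
    nlinarith [norm_nonneg a, norm_nonneg b]
  have hk₁₂ := mul_le_mul_of_nonneg_right (hnorm_le hk) (norm_nonneg (-p + k₂ * f))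
  have hk₂₁ := mul_le_mul_of_nonneg_right (hnorm_le ((norm_sub_rev _ _).trans hk))
    (norm_nonneg (p + k₁ * f))
  have hf : 2 * ‖f‖ ≤ (‖k₁‖ + ‖k₂‖) * (‖p + k₁ * f‖ + ‖-p + k₂ * f‖) :=
    calc 2 * ‖f‖ = ‖(k₁ - k₂) * ((p + k₁ * f) + (-p + k₂ * f))‖ := by
          rw [← hk, ← norm_mul]
          congr 1
          ring
      _ ≤ _ := by
          rw [norm_mul]
          exact mul_le_mul (norm_sub_le _ _) (norm_add_le _ _) (norm_nonneg _) (by positivity)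
  have hcontract : ‖f‖ ≤ (β₁ + β₂) * ‖f‖ := by linarith
  by_contra hne
  exact hcontract.not_gt (mul_lt_of_lt_one_left (norm_pos_iff.2 hne) hβ)

theorem exists_sq_eq_re_nonneg (c : ℂ) : ∃ k : ℂ, k ^ 2 = c ∧ 0 ≤ k.re := by
  obtain ⟨k, hk⟩ := IsAlgClosed.exists_pow_nat_eq c two_pos
  rcases le_total 0 k.re with h | h
  · exact ⟨k, hk, h⟩
  · exact ⟨-k, by rw [neg_sq, hk], by simpa using h⟩

/-- The potential `i sgn x`, except at `0`, where the value `-i` is immaterial. -/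
noncomputable def signPotential (x : ℝ) : ℂ := if 0 < x then Complex.I else -Complex.I

theorem signPotential_of_pos {x : ℝ} (hx : 0 < x) : signPotential x = Complex.I :=
  if_pos hx

theorem signPotential_of_nonpos {x : ℝ} (hx : x ≤ 0) : signPotential x = -Complex.I :=
  if_neg hx.not_gt

theorem measurable_signPotential : Measurable signPotential :=
  Measurable.ite measurableSet_Ioi measurable_const measurable_const

theorem norm_signPotential (x : ℝ) : ‖signPotential x‖ = 1 := by
  rw [signPotential]
  split_ifs <;> simp

theorem exists_sq_eq_and_boundary_le {c z : ℂ} {s w w' F P : ℝ → ℂ}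
    (hs : ∀ x ∈ Ioi 0, s x = c) (hFP : IsPrimitive F P)
    (hPF : IsPrimitive P fun x => (s x - z + w x) * F x)
    (hF : MemLp F 2 (volume.restrict (Ioi 0))) (hP : MemLp P 2 (volume.restrict (Ioi 0)))
    (hw : IsPrimitive w w') (hint : IntegrableOn (sobolevDensity w w') (Ioi 0))
    (hsmall : ∫ x in Ioi 0, sobolevDensity w w' x ≤ 1 / 2) :
    ∃ k : ℂ, k ^ 2 = c - z ∧
      (1 + ‖k‖) * ‖P 0 + k * F 0‖ ≤ (∫ x in Ioi 0, sobolevDensity w w' x) * ‖F 0‖ ∧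
      ∀ x, 0 ≤ x → ‖F x‖ ≤ 2 * ‖F 0‖ := by
  obtain ⟨k, hk, hre⟩ := exists_sq_eq_re_nonneg (c - z)
  have hq : EqOn (fun x => s x - c + w x) w (Ioi 0) := fun x hx => by simp [hs x hx]
  have hsol : IsDecayingSolution k (fun x => s x - c + w x) F P :=
    { re_nonneg := hre
      isPrimitive_fst := hFP
      isPrimitive_snd := by
        convert hPF using 3 with x
        rw [hk]
        ring
      memLp_fst := hF
      memLp_snd := hP
      integrableOn := (hw.integrableOn_of_sobolevDensity hint).1.congr_fun hq.symm
        measurableSet_Ioi }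
  exact ⟨k, hk, hsol.one_add_norm_mul_norm_snd_add_zero_le_sobolevDensity hq hw hint hsmall,
    fun x hx => hsol.norm_le_two_mul_of_sobolevDensity hq hw hint hsmall hx⟩

theorem eq_zero_of_integral_sobolevDensity_le {F P w w' : ℝ → ℂ} {z : ℂ} (hFP : IsPrimitive F P)
    (hPF : IsPrimitive P fun x => (signPotential x - z + w x) * F x) (hF : MemLp F 2)
    (hP : MemLp P 2) (hw : IsPrimitive w w') (hint : Integrable (sobolevDensity w w'))
    (hsmall : ∫ x, sobolevDensity w w' x ≤ 1 / 2) : F = 0 := by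
  have hrefl : MeasurePreserving (fun x : ℝ => -x) volume volume := Measure.measurePreserving_neg _
  have hPF₂ : IsPrimitive (fun x => -P (-x))
      fun x => (signPotential (-x) - z + w (-x)) * F (-x) := by
    simpa using hPF.comp_neg.smul (-1 : ℂ)
  have hint₂ : Integrable (sobolevDensity (fun x => w (-x)) fun x => -w' (-x)) :=
    hint.comp_neg.congr (.of_forall fun x => sobolevDensity_comp_neg.symm)
  have hsplit : (∫ x in Ioi 0, sobolevDensity w w' x) +
      ∫ x in Ioi 0, sobolevDensity (fun x => w (-x)) (fun x => -w' (-x)) x ≤ 1 / 2 := by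
    simp only [sobolevDensity_comp_neg]
    rwa [integral_comp_neg_Ioi, neg_zero, add_comm,
      intervalIntegral.integral_Iic_add_Ioi hint.integrableOn hint.integrableOn]
  have hnonneg (u u' : ℝ → ℂ) : 0 ≤ ∫ x in Ioi 0, sobolevDensity u u' x :=
    integral_nonneg fun _ => sobolevDensity_nonneg
  obtain ⟨k₁, hk₁, hbd₁, hle₁⟩ := exists_sq_eq_and_boundary_le
    (fun x hx => signPotential_of_pos hx) hFP hPF (hF.restrict _) (hP.restrict _) hw
    hint.integrableOn ((le_add_of_nonneg_right (hnonneg _ _)).trans hsplit)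
  obtain ⟨k₂, hk₂, hbd₂, hle₂⟩ := exists_sq_eq_and_boundary_le
    (fun x hx => signPotential_of_nonpos (neg_nonpos.2 (le_of_lt hx))) hFP.comp_neg hPF₂
    ((hF.comp_measurePreserving hrefl).restrict _)
    ((hP.comp_measurePreserving hrefl).neg.restrict _)
    hw.comp_neg hint₂.integrableOn ((le_add_of_nonneg_left (hnonneg _ _)).trans hsplit)
  simp only [neg_zero] at hbd₂ hle₂
  have hk : ‖k₁ ^ 2 - k₂ ^ 2‖ = 2 := by
    rw [hk₁, hk₂, sub_sub_sub_cancel_right, sub_neg_eq_add, ← two_mul]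
    simp
  have hF₀ : F 0 = 0 := eq_zero_of_norm_boundary_le hk hbd₁ hbd₂ (by linarith)
  refine funext fun x => norm_le_zero_iff.1 ?_
  rcases le_total 0 x with hx | hx
  · simpa [hF₀] using hle₁ x hx
  · simpa [hF₀] using hle₂ (-x) (neg_nonneg.2 hx)

/-! ### Eigenfunctions -/

theorem locallyIntegrable_signPotential : LocallyIntegrable signPotential :=
  (locallyIntegrable_const (1 : ℝ)).mono measurable_signPotential.aestronglyMeasurable
    (.of_forall fun x => by simp [norm_signPotential])

theorem integral_signPotential_mul {g : ℝ → ℂ} (hg : Integrable g) :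
    ∫ x, signPotential x * g x =
      Complex.I * (∫ x in Ioi 0, g x) - Complex.I * ∫ x in Iio 0, g x := by
  have hsg : Integrable fun x => signPotential x * g x :=
    hg.bdd_mul measurable_signPotential.aestronglyMeasurable
      (.of_forall fun x => (norm_signPotential x).le)
  rw [← intervalIntegral.integral_Iic_add_Ioi (b := 0) hsg.integrableOn hsg.integrableOn,
    ← integral_Iic_eq_integral_Iio,
    setIntegral_congr_fun measurableSet_Iic fun x hx => by rw [signPotential_of_nonpos hx],
    setIntegral_congr_fun measurableSet_Ioi fun x hx => by rw [signPotential_of_pos hx],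
    integral_const_mul, integral_const_mul]
  ring

theorem MemW1.locallyIntegrable_mul {p : ℝ≥0∞} {f g : ℝ → ℂ} (hf : MemW1 p f)
    (hg : LocallyIntegrable g) : LocallyIntegrable fun x => g x * f x := by
  obtain ⟨-, f', hf', -⟩ := hf
  obtain ⟨F, hfF, hF⟩ := hf'.exists_isPrimitive
  exact (hg.mul_continuous hF.continuous).congr (hfF.mono fun x hx => by simp only [hx])

section TestFunction

variable {φ : ℝ → ℝ} (hL : MemLp (fun x => (φ x : ℂ)) 2 (volume : Measure ℝ))

theorem setIntegral_mul_conj_toLp (f : ℝ → ℂ) (s : Set ℝ) :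
    ∫ x in s, f x * conj (hL.toLp _ x) = ∫ x in s, φ x • f x := by
  refine integral_congr_ae (ae_restrict_of_ae (hL.coeFn_toLp.mono fun x hx => ?_))
  simp only [hx, Complex.conj_ofReal, Complex.real_smul, mul_comm]

theorem integral_mul_conj_toLp (f : ℝ → ℂ) :
    ∫ x, f x * conj (hL.toLp _ x) = ∫ x, φ x • f x := by
  simpa only [setIntegral_univ] using setIntegral_mul_conj_toLp hL f univ

theorem perturbedForm_toLp (hφ : ContDiff ℝ ∞ φ) (hc : HasCompactSupport φ)
    (V : ℝ → ℂ) (ε : ℝ) (ψ : L2R) :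
    perturbedForm V ε ψ (hL.toLp _) = (∫ x, deriv φ x • weakDeriv ψ x) +
      (∫ x, φ x • (signPotential x * ψ x)) + ε * ∫ x, φ x • (V x * ψ x) := by
  have hφψ : Integrable fun x => φ x • ψ x :=
    ((Lp.memLp ψ).locallyIntegrable one_le_two).integrable_smul_left_of_hasCompactSupport
      hφ.continuous hc
  have hkin : ∫ x, weakDeriv ψ x * conj (weakDeriv (hL.toLp _) x) =
      ∫ x, deriv φ x • weakDeriv ψ x := by
    refine integral_congr_ae <| ((hasWeakDeriv_of_contDiff φ hφ).congr
      hL.coeFn_toLp.symm).weakDeriv_ae_eq.mono fun x hx => ?_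
    simp only [hx, Complex.conj_ofReal, Complex.real_smul, mul_comm]
  simp only [← mul_smul_comm, integral_signPotential_mul hφψ, perturbedForm, hkin,
    setIntegral_mul_conj_toLp, integral_mul_conj_toLp]
  ring

end TestFunction

theorem hasWeakDeriv_weakDeriv_of_mem_perturbedGraph {V : Lp ℂ 1 (volume : Measure ℝ)} {ε : ℝ}
    {ψ η : L2R} (h : (ψ, η) ∈ perturbedGraph V ε) :
    HasWeakDeriv (weakDeriv ψ)
      fun x => signPotential x * ψ x + ε * (V x * ψ x) - η x := by
  obtain ⟨hψ, hform⟩ := h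
  have hV : LocallyIntegrable V :=
    (memLp_one_iff_integrable.1 (Lp.memLp V)).locallyIntegrable
  have hsψ : LocallyIntegrable fun x => signPotential x * ψ x :=
    hψ.1.locallyIntegrable_mul locallyIntegrable_signPotential
  have hVψ : LocallyIntegrable fun x => V x * ψ x := hψ.1.locallyIntegrable_mul hV
  have hη : LocallyIntegrable η := (Lp.memLp η).locallyIntegrable one_le_two
  refine ⟨hψ.1.memLp_weakDeriv.1.2.1, (hsψ.add (hVψ.smul (ε : ℂ))).sub hη, fun φ hφ hc => ?_⟩
  have hL : MemLp (fun x => (φ x : ℂ)) 2 (volume : Measure ℝ) :=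
    (Complex.continuous_ofReal.comp hφ.continuous).memLp_of_hasCompactSupport
      (hc.comp_left Complex.ofReal_zero)
  have hi {f : ℝ → ℂ} (hf : LocallyIntegrable f) : Integrable fun x => φ x • f x :=
    hf.integrable_smul_left_of_hasCompactSupport hφ.continuous hc
  have hweak : (∫ x, deriv φ x • weakDeriv ψ x) + (∫ x, φ x • (signPotential x * ψ x)) +
      ε * (∫ x, φ x • (V x * ψ x)) = ∫ x, φ x • η x := by
    rw [← perturbedForm_toLp hL hφ hc, hform _ (toLp_mem_formDomain V hφ hc hL), L2.inner_def,
      ← integral_mul_conj_toLp hL]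
    rfl
  have hrhs : ∫ x, φ x • (signPotential x * ψ x + ε * (V x * ψ x) - η x) =
      (∫ x, φ x • (signPotential x * ψ x)) + ε * (∫ x, φ x • (V x * ψ x)) - ∫ x, φ x • η x := by
    simp only [smul_sub, smul_add, ← mul_smul_comm (φ _) (ε : ℂ)]
    have hsum : Integrable fun x =>
        φ x • (signPotential x * ψ x) + ε * (φ x • (V x * ψ x)) :=
      (hi hsψ).add ((hi hVψ).const_mul _)
    rw [integral_sub hsum (hi hη),
      integral_add (hi hsψ) ((hi hVψ).const_mul _), integral_const_mul]
  rw [hrhs]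
  linear_combination hweak

theorem exists_isPrimitive_of_mem_pointSpectrum {V : Lp ℂ 1 (volume : Measure ℝ)} {ε : ℝ} {z : ℂ}
    (hz : z ∈ pointSpectrum (perturbedOperator V ε)) :
    ∃ F P : ℝ → ℂ, F ≠ 0 ∧ MemLp F 2 ∧ MemLp P 2 ∧ IsPrimitive F P ∧
      IsPrimitive P fun x => (signPotential x - z + ε * V x) * F x := by
  obtain ⟨ψ, hne, hev⟩ := hz
  have hmem : ((ψ : L2R), z • (ψ : L2R)) ∈ perturbedGraph V ε := by
    rw [← perturbedOperator_graph, LinearPMap.mem_graph_iff]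
    exact ⟨ψ, rfl, hev⟩
  obtain ⟨hψ', hψ'2⟩ := hmem.1.1.memLp_weakDeriv
  obtain ⟨F, hψF, hF⟩ := hψ'.exists_isPrimitive
  obtain ⟨P, hψ'P, hP⟩ := (hasWeakDeriv_weakDeriv_of_mem_perturbedGraph hmem).exists_isPrimitive
  refine ⟨F, P, ?_, (Lp.memLp _).ae_eq hψF, hψ'2.ae_eq hψ'P, hF.congr_ae hψ'P, hP.congr_ae ?_⟩
  · rintro rfl
    exact hne (Lp.eq_zero_iff_ae_eq_zero.2 hψF)
  · filter_upwards [hψF, Lp.coeFn_smul z (ψ : L2R)] with x hx hzx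
    rw [hzx, Pi.smul_apply, hx, smul_eq_mul]
    ring

theorem integrable_mul_norm_of_integrable_one_add_pow_mul {f : ℝ → ℂ} {m : ℕ} (hm : Even m)
    (hm₀ : m ≠ 0) (hf : AEStronglyMeasurable f)
    (h : Integrable fun x : ℝ => ((1 + x ^ m : ℝ) : ℂ) * f x) :
    Integrable fun x => x * ‖f x‖ := by
  refine h.mono (aestronglyMeasurable_id.mul hf.norm) (.of_forall fun x => ?_)
  have hx : |x| ≤ 1 + |x| ^ m := by
    rcases le_total |x| 1 with hx | hx
    · exact hx.trans (le_add_of_nonneg_right (by positivity))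
    · exact (le_self_pow₀ hx hm₀).trans (le_add_of_nonneg_left zero_le_one)
  rw [norm_mul, norm_mul, norm_norm, Complex.norm_real, Real.norm_eq_abs, Real.norm_eq_abs,
    ← hm.pow_abs, abs_of_nonneg (by positivity : 0 ≤ 1 + |x| ^ m)]
  exact mul_le_mul_of_nonneg_right hx (norm_nonneg _)

theorem memW1_schwartz_toLp {p : ℝ≥0∞} [Fact (1 ≤ p)] (f : 𝓢(ℝ, ℂ)) :
    MemW1 p (f.toLp p : Lp ℂ p (volume : Measure ℝ)) := by
  have hf : IsPrimitive f (SchwartzMap.derivCLM ℝ ℂ f) :=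
    .of_hasDerivAt (fun x => by simpa only [SchwartzMap.derivCLM_apply] using f.hasDerivAt x)
      (SchwartzMap.derivCLM ℝ ℂ f).continuous
  exact ⟨Lp.memLp _, _, hf.hasWeakDeriv.congr (f.coeFn_toLp p).symm,
    (SchwartzMap.derivCLM ℝ ℂ f).memLp p⟩

theorem integrable_mul_norm_schwartz_toLp {p : ℝ≥0∞} [Fact (1 ≤ p)] (f : 𝓢(ℝ, ℂ)) :
    Integrable fun x : ℝ => x * ‖(f.toLp p : Lp ℂ p (volume : Measure ℝ)) x‖ := by
  refine (f.integrable_pow_mul volume 1).mono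
    (aestronglyMeasurable_id.mul (Lp.aestronglyMeasurable _).norm) ?_
  filter_upwards [f.coeFn_toLp p] with x hx
  simp [hx]

theorem theorem4_general (V : Lp ℂ 1 (volume : Measure ℝ))
    (hmom : Integrable fun x => x * ‖V x‖) (hV : MemW1 1 V) :
    ∃ ε₀ : ℝ, 0 < ε₀ ∧ ∀ ε : ℝ, |ε| < ε₀ → pointSpectrum (perturbedOperator V ε) = ∅ := by
  obtain ⟨hV₁, V', hVV', hV'⟩ := hV
  obtain ⟨w, hVw, hw⟩ := hVV'.exists_isPrimitive
  have hint : Integrable (sobolevDensity w V') :=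
    integrable_sobolevDensity ((memLp_one_iff_integrable.1 hV₁).congr hVw)
      (hmom.congr (hVw.mono fun x hx => by simp only [hx])) (memLp_one_iff_integrable.1 hV')
  set ν := ∫ x, sobolevDensity w V' x
  have hν : 0 ≤ ν := integral_nonneg fun x => sobolevDensity_nonneg
  refine ⟨1 / (2 * (ν + 1)), by positivity, fun ε hε => eq_empty_of_forall_notMem fun z hz => ?_⟩
  obtain ⟨F, P, hF₀, hF, hP, hFP, hPF⟩ := exists_isPrimitive_of_mem_pointSpectrum hz
  have hPF' : IsPrimitive P fun x => (signPotential x - z + ε * w x) * F x :=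
    hPF.congr_ae (hVw.mono fun x hx => by simp only [hx])
  have hdens : sobolevDensity (fun x => ε * w x) (fun x => ε * V' x) =
      fun x => |ε| * sobolevDensity w V' x :=
    funext fun x => by rw [sobolevDensity_const_mul, Complex.norm_real, Real.norm_eq_abs]
  refine hF₀ (eq_zero_of_integral_sobolevDensity_le hFP hPF' hF hP (hw.smul (ε : ℂ)) ?_ ?_)
  · exact hdens ▸ hint.const_mul _
  · rw [lt_div_iff₀ (by positivity)] at hε
    change ∫ x, sobolevDensity (fun x => ε * w x) (fun x => ε * V' x) x ≤ 1 / 2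
    rw [hdens, integral_const_mul]
    linarith [abs_nonneg ε]

theorem theorem4 :
    (∀ n : ℕ, 2 ≤ n → ∀ V : Lp ℂ 1 (volume : Measure ℝ),
      Integrable (fun x : ℝ => ((1 + x ^ (2 * n) : ℝ) : ℂ) * V x) → MemW1 1 V →
        ∃ ε₀ : ℝ, 0 < ε₀ ∧ ∃ C : ℝ, 0 < C ∧ ∀ ε : ℝ, 0 < ε → ε < ε₀ →
          pointSpectrum (perturbedOperator V ε) ⊆
            closure halfStrip ∩ {z : ℂ | C / ε ^ (2 * n) ≤ z.re}) ∧
    (∀ V : 𝓢(ℝ, ℂ), ∀ N : ℕ,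
      ∃ ε₀ : ℝ, 0 < ε₀ ∧ ∃ C : ℝ, 0 < C ∧ ∀ ε : ℝ, 0 < ε → ε < ε₀ →
        ∀ l ∈ pointSpectrum (perturbedOperator (V.toLp 1) ε),
          l ≠ 0 ∧ ‖l‖⁻¹ ≤ C * ε ^ N) := by
  constructor
  · intro n hn V hw hV
    obtain ⟨ε₀, hε₀, h⟩ := theorem4_general V (integrable_mul_norm_of_integrable_one_add_pow_mul
      (even_two_mul n) (by omega) (Lp.aestronglyMeasurable V) hw) hV
    refine ⟨ε₀, hε₀, 1, one_pos, fun ε hε hlt => ?_⟩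
    rw [h ε (by rwa [abs_of_pos hε])]
    exact empty_subset _
  · intro V N
    obtain ⟨ε₀, hε₀, h⟩ := theorem4_general (V.toLp 1 volume)
      (integrable_mul_norm_schwartz_toLp V) (memW1_schwartz_toLp V)
    refine ⟨ε₀, hε₀, 1, one_pos, fun ε hε hlt l hl => ?_⟩
    rw [h ε (by rwa [abs_of_pos hε])] at hl
    exact absurd hl (notMem_empty l)
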